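/- Let $k_1,k_2,k_3,k_4,k_5,\gamma>0$ with $k_2\neq k_3$, and consider on $\mathbb R$ the Cauchy problem for $U=(v,u,z,y,\phi,\theta,\eta,q)^T$, $$ \begin{cases} v_t-u_x-y-\theta=0,\\ u_t-k_1v_x+\gamma\eta_x=0,\\ z_t-y_x=0,\\ y_t-k_2z_x+k_1v=0,\\ \phi_t-\theta_x=0,\\ \theta_t-k_3\phi_x+k_1v=0,\\ \eta_t+k_4q_x+\gamma u_x=0,\\ q_t+k_5q+k_4\eta_x=0, \end{cases} \qquad U(\cdot,0)=U_0, $$ which is the first-order form, with $u=\varphi_t$, $y=\psi_t$, $\theta=w_t$, $v=\varphi_x+\psi+w$, $z=\psi_x$, $\phi=w_x$, of the laminated Timoshenko system with interfacial slip coupled to heat conduction of Cattaneo type through its first equation, $$ \begin{cases} \varphi_{tt}-k_1(\varphi_x+\psi+w)_x+\gamma\eta_x=0,\\ \psi_{tt}-k_2\psi_{xx}+k_1(\varphi_x+\psi+w)=0,\\ w_{tt}-k_3w_{xx}+k_1(\varphi_x+\psi+w)=0,\\ \eta_t+k_4q_x+\gamma\varphi_{xt}=0,\\ q_t+k_5q+k_4\eta_x=0.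 \end{cases} $$ Let $N,\ell\in\mathbb N$ with $1\le\ell\le N$ and let $j\in\{0,\dots,N-\ell\}$. Then there is a constant $c_0>0$, depending only on $k_1,\dots,k_5,\gamma,N,\ell,j$, such that for every $U_0\in H^N(\mathbb R)\cap L^1(\mathbb R)$ (with values in $\mathbb C^8$, in particular in $\mathbb R^8$) and every solution $U\in C([0,\infty);L^2(\mathbb R))$ of this problem (the equations being understood in the sense of distributions in $x$), $\partial_x^jU(\cdot,t)\in L^2(\mathbb R)$ for all $t\ge0$ and $$ \|\partial_x^jU(\cdot,t)\|_{L^2(\mathbb R)}\le c_0(1+t)^{-1/12-j/6}\,\|U_0\|_{L^1(\mathbb R)}+c_0(1+t)^{-\ell/2}\,\|\partial_x^{j+\ell}U_0\|_{L^2(\mathbb R)}\qquad\text{for all }t\ge0 . $$ -/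

import Mathlib

open MeasureTheory Set
open scoped SchwartzMap LineDeriv

noncomputable section

/-- The space of values of the unknown `U = (v, u, z, y, φ, θ, η, q)`, with its Euclidean norm.
Complex values are allowed; real-valued functions are a special case. -/
abbrev StateC : Type := EuclideanSpace ℂ (Fin 8)

/-- `L²(ℝ)` with values in the state space. -/
abbrev L2State : Type := Lp StateC 2 (volume : Measure ℝ)

/-- The matrix `A₁` of the first-order form of the Cattaneo system, for the ordering
`(v, u, z, y, φ, θ, η, q)` of the unknowns. -/
def cattaneoMatrix₁ (k₁ k₂ k₃ k₄ γ τ₁ τ₂ τ₃ : ℝ) : Matrix (Fin 8) (Fin 8) ℝ :=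
  !![  0,     -1,    0,    0,     0,    0,      0,  0;
     -k₁,      0,    0,    0,     0,    0, τ₁ * γ,  0;
       0,      0,    0,   -1,     0,    0,      0,  0;
       0,      0,  -k₂,    0,     0,    0, τ₂ * γ,  0;
       0,      0,    0,    0,     0,   -1,      0,  0;
       0,      0,    0,    0,   -k₃,    0, τ₃ * γ,  0;
       0, γ * τ₁,    0, γ * τ₂,   0, γ * τ₃,    0, k₄;
       0,      0,    0,    0,     0,    0,     k₄,  0]

/-- The matrix `A₀` of the first-order form of the Cattaneo system. -/
def cattaneoMatrix₀ (k₁ k₅ : ℝ) : Matrix (Fin 8) (Fin 8) ℝ :=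
  !![ 0, 0, 0, -1, 0, -1, 0,  0;
      0, 0, 0,  0, 0,  0, 0,  0;
      0, 0, 0,  0, 0,  0, 0,  0;
     k₁, 0, 0,  0, 0,  0, 0,  0;
      0, 0, 0,  0, 0,  0, 0,  0;
     k₁, 0, 0,  0, 0,  0, 0,  0;
      0, 0, 0,  0, 0,  0, 0,  0;
      0, 0, 0,  0, 0,  0, 0, k₅]

/-- The action of a real matrix on the state space. -/
def matAct (A : Matrix (Fin 8) (Fin 8) ℝ) : StateC →L[ℂ] StateC :=
  Matrix.toEuclideanCLM (𝕜 := ℂ) (A.map (fun r : ℝ => (r : ℂ)))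

/-- `U : [0, ∞) → L²(ℝ)` is a solution of the Cauchy problem
`U_t + A₁ U_x + A₀ U = 0`, `U(·, 0) = U₀`: it is continuous in time with values in `L²(ℝ)`, and
the equation holds on `[0, ∞)` in the sense of (tempered) distributions in the space variable,
that is, after pairing with an arbitrary Schwartz function `g`. (The values of `U` at negative
times are irrelevant.) -/
structure IsCauchySolution (A₁ A₀ : Matrix (Fin 8) (Fin 8) ℝ) (U₀ : L2State)
    (U : ℝ → L2State) : Prop where
  continuousOn : ContinuousOn U (Ici 0)
  initial : U 0 = U₀
  equation : ∀ g : 𝓢(ℝ, ℂ), ∀ t : ℝ, 0 ≤ t →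
    HasDerivWithinAt (fun s : ℝ => (U s : 𝓢'(ℝ, StateC)) g)
      (-(matAct A₁ ((∂_{(1 : ℝ)} (U t : 𝓢'(ℝ, StateC))) g))
        - matAct A₀ ((U t : 𝓢'(ℝ, StateC)) g))
      (Ici 0) t

/-- The `n`-th distributional derivative of `f ∈ L²(ℝ)` is (represented by) `h ∈ L²(ℝ)`. -/
def HasL2Deriv (n : ℕ) (f h : L2State) : Prop :=
  ∂^{fun _ : Fin n => (1 : ℝ)} (f : 𝓢'(ℝ, StateC)) = (h : 𝓢'(ℝ, StateC))

end

/-! After a Fourier transform the system becomes, for each frequency `ξ`, a linear ODE whose energy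
is dissipated only by `q`, at rate `2 * k₅`. The damping reaches the other components through the
coupling: `q` controls `η`, then `u`, `v`, `y + θ`, `k₂ z + k₃ φ`, `y - θ` and finally `k₂ z - k₃
φ`. Each link is a quadratic cross term whose time derivative contains minus the square of the next
variable. The last two links see only the difference of the two wave equations, in which `v`
cancels; passing from `k₂ z + k₃ φ` to `y - θ` costs a factor `k₂ - k₃`, which is where `k₂ ≠ k₃`
enters.

Weighting the variables by powers of `ξ * e` and `e`, with `e = (1 + ξ²)^(-1/2)`, bounds every error
coefficient uniformly in `ξ`. A large multiple of the energy plus a combination of cross terms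
(`exists_chain_combination`, `flowDeriv_crossOp_le`) is then a uniform Lyapunov functional
(`exists_lyapunov`). It gives modewise decay at a rate comparable to `ξ^6 / (1 + ξ^2)^4`
(`exists_fourier_decay`).

This rate is of order `ξ^6` at low frequencies. There the Fourier transform of the data is bounded
by its `L¹` norm, and scaling `ξ` by `(1 + t)^(1/6)` gives the first term. At high frequencies the
rate is of order `ξ^(-2)`, so a decay of `(1 + t)^(-ℓ/2)` is bought with `ℓ` derivatives
(`exists_exp_dampingRate_le`). Plancherel's identity assembles the two parts. -/

open ComplexConjugate
open scoped ENNReal FourierTransform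

/-! ### Abstract combination of a chain of functionals -/

/-- Damping propagates along a chain of functionals: if the `i`-th functional controls `X (i + 1)`
up to `X 0, …, X i` and a product of these with `X (i + 2)`, then a positive combination of the
functionals controls all the `X i` up to `X 0`. -/
theorem exists_chain_combination {Ω : Type*} (X f : ℕ → Ω → ℝ) (m : ℕ)
    (hf : ∀ i < m, ∃ c C : ℝ, 0 < c ∧ 0 ≤ C ∧ ∀ ω, f i ω ≤ -c * X (i + 1) ω ^ 2 +
      C * (∑ j ∈ Finset.range (i + 1), X j ω) * (∑ j ∈ Finset.range (i + 3), X j ω)) :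
    ∀ n ≤ m, ∀ K ε : ℝ, 0 < K → 0 < ε → ∃ (a : ℕ → ℝ) (B : ℝ), 0 ≤ B ∧ ∀ ω,
      ∑ i ∈ Finset.range n, a i * f i ω ≤
        -K * ∑ j ∈ Finset.range (n + 1), X j ω ^ 2 + B * X 0 ω ^ 2 + ε * X (n + 1) ω ^ 2 := by
  intro n
  induction n with
  | zero =>
    intro _ K ε hK hε
    refine ⟨0, K, hK.le, fun ω => ?_⟩
    have := mul_nonneg hε.le (sq_nonneg (X 1 ω))
    simp
    linarith
  | succ n ih =>
    intro hn K ε hK hε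
    obtain ⟨c, C, hc, hC, h⟩ := hf n (by omega)
    -- The new functional yields `-4 * K * x ^ 2`: one `K` is kept for the conclusion, one pays for
    -- the error left by the induction hypothesis, one for Young's inequality on `S * x`; the last
    -- is spare.
    set A : ℝ := 4 * K / c with hA
    have hA0 : 0 < A := by positivity
    set G : ℝ := A * C + (A * C) ^ 2 / (4 * K) + (A * C) ^ 2 / (4 * ε) with hG
    have hG0 : 0 ≤ G := by positivity
    -- `G` collects everything the new functional costs in `S ^ 2`; the induction hypothesis is
    -- asked for enough extra damping to absorb it, since `S ^ 2 ≤ (n + 1) * Q`.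
    obtain ⟨a, B, hB, hab⟩ := ih (by omega) (K + G * (n + 1)) K (by positivity) hK
    refine ⟨Function.update a n A, B, hB, fun ω => ?_⟩
    have h1 := hab ω
    have h2 := mul_le_mul_of_nonneg_left (h ω) hA0.le
    rw [Finset.sum_range_succ, Finset.sum_range_succ _ (n + 1), Function.update_self]
    have h3 : ∑ i ∈ Finset.range n, Function.update a n A i * f i ω
        = ∑ i ∈ Finset.range n, a i * f i ω := by
      refine Finset.sum_congr rfl fun i hi => ?_
      rw [Function.update_of_ne (by have := Finset.mem_range.1 hi; omega)]
    rw [h3]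
    rw [Finset.sum_range_succ (fun j => X j ω) (n + 2),
      Finset.sum_range_succ (fun j => X j ω) (n + 1)] at h2
    set S := ∑ j ∈ Finset.range (n + 1), X j ω with hS
    set Q := ∑ j ∈ Finset.range (n + 1), X j ω ^ 2 with hQ
    have hSQ : S ^ 2 ≤ (n + 1) * Q := by
      have := sq_sum_le_card_mul_sum_sq (s := Finset.range (n + 1)) (f := fun j => X j ω)
      simpa using this
    set x := X (n + 1) ω
    set y := X (n + 1 + 1) ω
    have h4 : A * C * S * x ≤ K * x ^ 2 + (A * C) ^ 2 / (4 * K) * S ^ 2 := by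
      have : K * x ^ 2 + (A * C) ^ 2 / (4 * K) * S ^ 2 - A * C * S * x
        = K * (x - A * C * S / (2 * K)) ^ 2 := by field_simp; ring
      nlinarith [mul_nonneg hK.le (sq_nonneg (x - A * C * S / (2 * K)))]
    have h5 : A * C * S * y ≤ ε * y ^ 2 + (A * C) ^ 2 / (4 * ε) * S ^ 2 := by
      have : ε * y ^ 2 + (A * C) ^ 2 / (4 * ε) * S ^ 2 - A * C * S * y
        = ε * (y - A * C * S / (2 * ε)) ^ 2 := by field_simp; ring
      nlinarith [mul_nonneg hε.le (sq_nonneg (y - A * C * S / (2 * ε)))]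
    have h6 : G * S ^ 2 ≤ G * (n + 1) * Q := by
      rw [mul_assoc]; exact mul_le_mul_of_nonneg_left hSQ hG0
    have h7 : A * (-c * x ^ 2 + C * S * (S + x + y)) = -(4 * K) * x ^ 2 + A * C * S ^ 2
        + A * C * S * x + A * C * S * y := by
      have : A * c = 4 * K := by rw [hA]; field_simp
      linear_combination (-x ^ 2) * this
    rw [h7] at h2
    have h8 : G * S ^ 2 = A * C * S ^ 2 + (A * C) ^ 2 / (4 * K) * S ^ 2
      + (A * C) ^ 2 / (4 * ε) * S ^ 2 := by rw [hG]; ring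
    nlinarith [mul_nonneg hK.le (sq_nonneg x)]

/-! ### Fourier symbol, rescaled variables and cross terms -/

/-- The matrix of the sesquilinear form `(x, y) ↦ c * (a ⬝ x) * conj (b ⬝ y)`. -/
noncomputable def rankOneOp (c : ℂ) (a b : Fin 8 → ℝ) : StateC →L[ℂ] StateC :=
  Matrix.toEuclideanCLM (𝕜 := ℂ) (Matrix.of fun i j => c * b i * a j)

theorem re_inner_rankOneOp (c : ℂ) (a b : Fin 8 → ℝ) (x y : StateC) :
    (inner ℂ (rankOneOp c a b x) y).re =
      (c * (∑ i, a i * x i) * (starRingEnd ℂ) (∑ i, b i * y i)).re := by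
  have h : ∀ i, rankOneOp c a b x i = c * b i * ∑ j, a j * x j := fun i => by
    simp [rankOneOp, Matrix.mulVec, dotProduct, Finset.mul_sum, mul_assoc]
  have h2 : inner ℂ (rankOneOp c a b x) y
      = (starRingEnd ℂ) (c * (∑ i, a i * x i) * (starRingEnd ℂ) (∑ i, b i * y i)) := by
    simp only [PiLp.inner_apply, h, map_sum, map_mul, RCLike.inner_apply, Complex.conj_ofReal,
      Complex.conj_conj, Finset.mul_sum]
    refine Finset.sum_congr rfl fun i _ => ?_
    simp only [Finset.sum_mul]
    refine Finset.sum_congr rfl fun j _ => ?_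
    ring
  rw [h2, Complex.conj_re]

/-- The Fourier symbol at (angular) frequency `ξ` of the Cattaneo system. -/
noncomputable def cattaneoSymbol (k₁ k₂ k₃ k₄ k₅ γ : ℝ) (ξ : ℝ) : StateC →L[ℂ] StateC :=
  -((Complex.I * ξ) • matAct (cattaneoMatrix₁ k₁ k₂ k₃ k₄ γ 1 0 0))
    - matAct (cattaneoMatrix₀ k₁ k₅)

theorem cattaneoSymbol_apply (k₁ k₂ k₃ k₄ k₅ γ ξ : ℝ) (x : StateC) :
    (cattaneoSymbol k₁ k₂ k₃ k₄ k₅ γ ξ x).ofLp =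
      ![Complex.I * ξ * x 1 + x 3 + x 5,
        Complex.I * ξ * (k₁ * x 0 - γ * x 6),
        Complex.I * ξ * x 3,
        Complex.I * ξ * (k₂ * x 2) - k₁ * x 0,
        Complex.I * ξ * x 5,
        Complex.I * ξ * (k₃ * x 4) - k₁ * x 0,
        -(Complex.I * ξ * (k₄ * x 7 + γ * x 1)),
        -(k₅ * x 7) - Complex.I * ξ * (k₄ * x 6)] := by
  funext i
  fin_cases i <;>
    simp [cattaneoSymbol, matAct, cattaneoMatrix₁, cattaneoMatrix₀, Matrix.mulVec, dotProduct,
      Fin.sum_univ_eight] <;> first | ring1 | (left; ring1)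

/-- The low/high frequency weight `(1 + ξ²)^(-1/2)`. -/
noncomputable def freqWeight (ξ : ℝ) : ℝ := (√(1 + ξ ^ 2))⁻¹

theorem freqWeight_pos (ξ : ℝ) : 0 < freqWeight ξ := by
  unfold freqWeight; positivity

theorem freqWeight_sq (ξ : ℝ) : freqWeight ξ ^ 2 * (1 + ξ ^ 2) = 1 := by
  unfold freqWeight
  rw [inv_pow, Real.sq_sqrt (by positivity)]
  field_simp

theorem freqWeight_le_one (ξ : ℝ) : freqWeight ξ ≤ 1 := by
  nlinarith [freqWeight_pos ξ, freqWeight_sq ξ, mul_nonneg (sq_nonneg (freqWeight ξ)) (sq_nonneg ξ)]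

theorem abs_mul_freqWeight_le_one (ξ : ℝ) : |ξ * freqWeight ξ| ≤ 1 := by
  rw [abs_le_one_iff_mul_self_le_one]
  nlinarith [freqWeight_sq ξ, sq_nonneg (freqWeight ξ)]

/-- The state components, rescaled by their dissipation rates and ordered along the chain
`q → η → u → v → y + θ → k₂ z + k₃ φ → y - θ → k₂ z - k₃ φ`. -/
noncomputable def chainVar (k₂ k₃ ξ e : ℝ) (x : StateC) : ℕ → ℂ
  | 0 => x 7
  | 1 => ((ξ * e : ℝ) : ℂ) * x 6
  | 2 => (((ξ * e) ^ 2 : ℝ) : ℂ) * x 1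
  | 3 => (((ξ * e) ^ 3 : ℝ) : ℂ) * x 0
  | 4 => (((ξ * e) ^ 3 * e : ℝ) : ℂ) * (x 3 + x 5)
  | 5 => (((ξ * e) ^ 3 * e : ℝ) : ℂ) * (k₂ * x 2 + k₃ * x 4)
  | 6 => (((ξ * e) ^ 3 * e : ℝ) : ℂ) * (x 3 - x 5)
  | 7 => (((ξ * e) ^ 3 * e : ℝ) : ℂ) * (k₂ * x 2 - k₃ * x 4)
  | _ => 0

/-- The operators of the cross terms of the Lyapunov functional. -/
noncomputable def crossOp (k₂ k₃ ξ e : ℝ) : ℕ → StateC →L[ℂ] StateC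
  | 0 => rankOneOp ((ξ * e ^ 2 : ℝ) * Complex.I) ![0, 0, 0, 0, 0, 0, 1, 0] ![0, 0, 0, 0, 0, 0, 0, 1]
  | 1 => rankOneOp ((ξ ^ 3 * e ^ 4 : ℝ) * Complex.I) ![0, 1, 0, 0, 0, 0, 0, 0]
      ![0, 0, 0, 0, 0, 0, 1, 0]
  | 2 => rankOneOp ((-(ξ ^ 5 * e ^ 6) : ℝ) * Complex.I) ![1, 0, 0, 0, 0, 0, 0, 0]
      ![0, 1, 0, 0, 0, 0, 0, 0]
  | 3 => rankOneOp ((-(ξ ^ 6 * e ^ 8) : ℝ) : ℂ) ![1, 0, 0, 0, 0, 0, 0, 0] ![0, 0, 0, 1, 0, 1, 0, 0]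
  | 4 => rankOneOp ((ξ ^ 4 * e ^ 8 : ℝ) : ℂ) ![0, 1, 0, 0, 0, 0, 0, 0] ![0, 0, k₂, 0, k₃, 0, 0, 0]
      + rankOneOp ((ξ ^ 5 * e ^ 8 / 2 : ℝ) * Complex.I) ![0, 0, 0, 1, 0, 1, 0, 0]
        ![0, 0, k₂, 0, k₃, 0, 0, 0]
  | 5 => rankOneOp ((-((k₂ - k₃) * (ξ ^ 5 * e ^ 8)) : ℝ) * Complex.I) ![0, 0, 0, 1, 0, -1, 0, 0]
      ![0, 0, k₂, 0, k₃, 0, 0, 0]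
  | 6 => rankOneOp ((-(ξ ^ 5 * e ^ 8) : ℝ) * Complex.I) ![0, 0, k₂, 0, -k₃, 0, 0, 0]
      ![0, 0, 0, 1, 0, -1, 0, 0]
  | _ => 0

/-- The rate of change of `Re ⟪K x, x⟫` along the flow `x' = M x`. -/
noncomputable def flowDeriv (M K : StateC →L[ℂ] StateC) (x : StateC) : ℝ :=
  (inner ℂ (K (M x)) x).re + (inner ℂ (K x) (M x)).re


section
variable (k₁ k₂ k₃ k₄ k₅ γ ξ e : ℝ) (x : StateC)

/-- In this and the following identities, the powers of `ξ` and `e` in `crossOp` make the negative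
square appear with a constant coefficient, while the other coefficients are polynomials in `ξ * e`
and `e`, hence bounded when `e = freqWeight ξ`. -/
theorem flowDeriv_crossOp_zero :
    flowDeriv (cattaneoSymbol k₁ k₂ k₃ k₄ k₅ γ ξ) (crossOp k₂ k₃ ξ e 0) x =
    -k₄ * ‖chainVar k₂ k₃ ξ e x 1‖ ^ 2 + k₄ * (ξ * e) ^ 2 * ‖chainVar k₂ k₃ ξ e x 0‖ ^ 2
      + γ * (chainVar k₂ k₃ ξ e x 2 * conj (chainVar k₂ k₃ ξ e x 0)).re
      + (-k₅ * e) * (Complex.I * chainVar k₂ k₃ ξ e x 1 * conj (chainVar k₂ k₃ ξ e x 0)).re := by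
  simp only [flowDeriv, crossOp, re_inner_rankOneOp, cattaneoSymbol_apply, chainVar,
    Fin.sum_univ_eight, ← Complex.normSq_eq_norm_sq]
  simp [Complex.normSq_apply, -Complex.ofReal_mul, -Complex.ofReal_pow, -Complex.ofReal_neg,
    -Complex.ofReal_div, -Complex.ofReal_sub]
  ring

theorem flowDeriv_crossOp_one :
    flowDeriv (cattaneoSymbol k₁ k₂ k₃ k₄ k₅ γ ξ) (crossOp k₂ k₃ ξ e 1) x =
    -γ * ‖chainVar k₂ k₃ ξ e x 2‖ ^ 2 + γ * (ξ * e) ^ 2 * ‖chainVar k₂ k₃ ξ e x 1‖ ^ 2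
      + (-k₁) * (chainVar k₂ k₃ ξ e x 3 * conj (chainVar k₂ k₃ ξ e x 1)).re
      + (-k₄ * (ξ * e) ^ 2) * (chainVar k₂ k₃ ξ e x 2 * conj (chainVar k₂ k₃ ξ e x 0)).re := by
  simp only [flowDeriv, crossOp, re_inner_rankOneOp, cattaneoSymbol_apply, chainVar,
    Fin.sum_univ_eight, ← Complex.normSq_eq_norm_sq]
  simp [Complex.normSq_apply, -Complex.ofReal_mul, -Complex.ofReal_pow, -Complex.ofReal_neg,
    -Complex.ofReal_div, -Complex.ofReal_sub]
  ring

theorem flowDeriv_crossOp_two :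
    flowDeriv (cattaneoSymbol k₁ k₂ k₃ k₄ k₅ γ ξ) (crossOp k₂ k₃ ξ e 2) x =
    -k₁ * ‖chainVar k₂ k₃ ξ e x 3‖ ^ 2 + (ξ * e) ^ 2 * ‖chainVar k₂ k₃ ξ e x 2‖ ^ 2
      + (γ * (ξ * e) ^ 2) * (chainVar k₂ k₃ ξ e x 3 * conj (chainVar k₂ k₃ ξ e x 1)).re
      + (-1) * (Complex.I * chainVar k₂ k₃ ξ e x 4 * conj (chainVar k₂ k₃ ξ e x 2)).re := by
  simp only [flowDeriv, crossOp, re_inner_rankOneOp, cattaneoSymbol_apply, chainVar,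
    Fin.sum_univ_eight, ← Complex.normSq_eq_norm_sq]
  simp [Complex.normSq_apply, -Complex.ofReal_mul, -Complex.ofReal_pow, -Complex.ofReal_neg,
    -Complex.ofReal_div, -Complex.ofReal_sub]
  ring

theorem flowDeriv_crossOp_three :
    flowDeriv (cattaneoSymbol k₁ k₂ k₃ k₄ k₅ γ ξ) (crossOp k₂ k₃ ξ e 3) x =
    -1 * ‖chainVar k₂ k₃ ξ e x 4‖ ^ 2 + 2 * k₁ * e ^ 2 * ‖chainVar k₂ k₃ ξ e x 3‖ ^ 2
      + (-(ξ * e) ^ 2) * (Complex.I * chainVar k₂ k₃ ξ e x 2 * conj (chainVar k₂ k₃ ξ e x 4)).re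
      + (ξ * e) * (Complex.I * chainVar k₂ k₃ ξ e x 3 * conj (chainVar k₂ k₃ ξ e x 5)).re := by
  simp only [flowDeriv, crossOp, re_inner_rankOneOp, cattaneoSymbol_apply, chainVar,
    Fin.sum_univ_eight, ← Complex.normSq_eq_norm_sq]
  simp [Complex.normSq_apply, -Complex.ofReal_mul, -Complex.ofReal_pow, -Complex.ofReal_neg,
    -Complex.ofReal_div, -Complex.ofReal_sub]
  ring

/-- The product of `y + θ` with `k₂ z + k₃ φ` alone produces a `v`-term too large at low frequency,
as `y + θ` has `-2 * k₁ * v` in its derivative. The additional product of `u` with `k₂ z + k₃ φ`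
cancels it exactly, because `u` has `k₁ v_x` in its derivative. -/
theorem flowDeriv_crossOp_four :
    flowDeriv (cattaneoSymbol k₁ k₂ k₃ k₄ k₅ γ ξ) (crossOp k₂ k₃ ξ e 4) x =
    -(1 / 2) * ‖chainVar k₂ k₃ ξ e x 5‖ ^ 2 + (k₂ + k₃) / 4 * ‖chainVar k₂ k₃ ξ e x 4‖ ^ 2
      + (-γ * (ξ * e) * e ^ 2) *
        (Complex.I * chainVar k₂ k₃ ξ e x 1 * conj (chainVar k₂ k₃ ξ e x 5)).re
      + (-(e ^ 2 * ((k₂ + k₃) / 2))) *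
        (Complex.I * chainVar k₂ k₃ ξ e x 2 * conj (chainVar k₂ k₃ ξ e x 4)).re
      + (-(e ^ 2 * ((k₂ - k₃) / 2))) *
        (Complex.I * chainVar k₂ k₃ ξ e x 2 * conj (chainVar k₂ k₃ ξ e x 6)).re
      + ((k₂ - k₃) / 4) * (chainVar k₂ k₃ ξ e x 4 * conj (chainVar k₂ k₃ ξ e x 6)).re := by
  simp only [flowDeriv, crossOp, add_apply, inner_add_left, Complex.add_re,
    re_inner_rankOneOp, cattaneoSymbol_apply, chainVar,
    Fin.sum_univ_eight, ← Complex.normSq_eq_norm_sq]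
  simp [Complex.normSq_apply, -Complex.ofReal_mul, -Complex.ofReal_pow, -Complex.ofReal_neg,
    -Complex.ofReal_div, -Complex.ofReal_sub]
  ring

/-- The equation for `y - θ` is free of `v`. The derivative of `k₂ z + k₃ φ` contains `y - θ` with
coefficient `(k₂ - k₃) / 2`; the prefactor `k₂ - k₃` of the cross term turns it into a negative
square. -/
theorem flowDeriv_crossOp_five :
    flowDeriv (cattaneoSymbol k₁ k₂ k₃ k₄ k₅ γ ξ) (crossOp k₂ k₃ ξ e 5) x =
    -((k₂ - k₃) ^ 2 / 2) * ‖chainVar k₂ k₃ ξ e x 6‖ ^ 2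
      + (k₂ - k₃) * (chainVar k₂ k₃ ξ e x 7 * conj (chainVar k₂ k₃ ξ e x 5)).re
      + (-((k₂ - k₃) * ((k₂ + k₃) / 2))) * (chainVar k₂ k₃ ξ e x 4 * conj (chainVar k₂ k₃ ξ e x 6)).re := by
  simp only [flowDeriv, crossOp, re_inner_rankOneOp, cattaneoSymbol_apply, chainVar,
    Fin.sum_univ_eight, ← Complex.normSq_eq_norm_sq]
  simp [Complex.normSq_apply, -Complex.ofReal_mul, -Complex.ofReal_pow, -Complex.ofReal_neg,
    -Complex.ofReal_div, -Complex.ofReal_sub]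
  ring

theorem flowDeriv_crossOp_six :
    flowDeriv (cattaneoSymbol k₁ k₂ k₃ k₄ k₅ γ ξ) (crossOp k₂ k₃ ξ e 6) x =
    -1 * ‖chainVar k₂ k₃ ξ e x 7‖ ^ 2 + (k₂ + k₃) / 2 * ‖chainVar k₂ k₃ ξ e x 6‖ ^ 2
      + ((k₂ - k₃) / 2) * (chainVar k₂ k₃ ξ e x 4 * conj (chainVar k₂ k₃ ξ e x 6)).re := by
  simp only [flowDeriv, crossOp, re_inner_rankOneOp, cattaneoSymbol_apply, chainVar,
    Fin.sum_univ_eight, ← Complex.normSq_eq_norm_sq]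
  simp [Complex.normSq_apply, -Complex.ofReal_mul, -Complex.ofReal_pow, -Complex.ofReal_neg,
    -Complex.ofReal_div, -Complex.ofReal_sub]
  ring

end

/-! ### Uniform estimates for the cross terms -/

theorem norm_mul_norm_le_sum_mul_sum (a : ℕ → ℂ) {i j m n : ℕ}
    (h : (i < m ∧ j < n) ∨ (j < m ∧ i < n)) :
    ‖a i‖ * ‖a j‖ ≤ (∑ l ∈ Finset.range m, ‖a l‖) * ∑ l ∈ Finset.range n, ‖a l‖ := by
  have key : ∀ {i j : ℕ}, i < m → j < n →
      ‖a i‖ * ‖a j‖ ≤ (∑ l ∈ Finset.range m, ‖a l‖) * ∑ l ∈ Finset.range n, ‖a l‖ :=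
    fun {i j} hi hj => mul_le_mul
      (Finset.single_le_sum (f := fun l => ‖a l‖) (fun l _ => norm_nonneg _) (Finset.mem_range.2 hi))
      (Finset.single_le_sum (f := fun l => ‖a l‖) (fun l _ => norm_nonneg _) (Finset.mem_range.2 hj))
      (norm_nonneg _) (Finset.sum_nonneg fun l _ => norm_nonneg _)
  rcases h with h | h
  · exact key h.1 h.2
  · rw [mul_comm ‖a i‖]; exact key h.1 h.2

theorem mul_re_mul_conj_le (a : ℕ → ℂ) {t T : ℝ} (ht : |t| ≤ T) {i j : ℕ} (m n : ℕ)
    (h : (i < m ∧ j < n) ∨ (j < m ∧ i < n)) (c : ℂ) (hc : ‖c‖ = 1) :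
    t * (c * a i * conj (a j)).re ≤
      T * ((∑ l ∈ Finset.range m, ‖a l‖) * ∑ l ∈ Finset.range n, ‖a l‖) := by
  have h1 : |(c * a i * conj (a j)).re| ≤ ‖a i‖ * ‖a j‖ := by
    simpa [hc] using Complex.abs_re_le_norm (c * a i * conj (a j))
  calc t * (c * a i * conj (a j)).re ≤ |t * (c * a i * conj (a j)).re| := le_abs_self _
    _ = |t| * |(c * a i * conj (a j)).re| := abs_mul _ _
    _ ≤ T * ((∑ l ∈ Finset.range m, ‖a l‖) * ∑ l ∈ Finset.range n, ‖a l‖) := by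
      have hT := (abs_nonneg _).trans ht
      gcongr
      exact h1.trans (norm_mul_norm_le_sum_mul_sum a h)

theorem mul_norm_sq_le (a : ℕ → ℂ) {t T : ℝ} (ht : |t| ≤ T) {i : ℕ} (m n : ℕ)
    (hm : i < m) (hn : i < n) :
    t * ‖a i‖ ^ 2 ≤ T * ((∑ l ∈ Finset.range m, ‖a l‖) * ∑ l ∈ Finset.range n, ‖a l‖) := by
  calc t * ‖a i‖ ^ 2 ≤ |t| * ‖a i‖ ^ 2 := by gcongr; exact le_abs_self _
    _ ≤ T * ((∑ l ∈ Finset.range m, ‖a l‖) * ∑ l ∈ Finset.range n, ‖a l‖) := by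
      have hT := (abs_nonneg _).trans ht
      gcongr
      rw [sq]
      exact norm_mul_norm_le_sum_mul_sum a (Or.inl ⟨hm, hn⟩)

/-- This is the hypothesis of `exists_chain_combination`: every error product in the derivative
identities has one factor among the variables already controlled and the other at most one place
beyond the newly controlled one. -/
theorem flowDeriv_crossOp_le {k₁ k₂ k₃ k₄ k₅ γ : ℝ} (hk₁ : 0 < k₁) (hk₄ : 0 < k₄) (hγ : 0 < γ)
    (hk : k₂ ≠ k₃) (i : ℕ) (hi : i < 7) : ∃ c C : ℝ, 0 < c ∧ 0 ≤ C ∧ ∀ ω : ℝ × StateC,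
      flowDeriv (cattaneoSymbol k₁ k₂ k₃ k₄ k₅ γ ω.1) (crossOp k₂ k₃ ω.1 (freqWeight ω.1) i) ω.2 ≤
        -c * ‖chainVar k₂ k₃ ω.1 (freqWeight ω.1) ω.2 (i + 1)‖ ^ 2 +
        C * (∑ j ∈ Finset.range (i + 1), ‖chainVar k₂ k₃ ω.1 (freqWeight ω.1) ω.2 j‖) *
          (∑ j ∈ Finset.range (i + 3), ‖chainVar k₂ k₃ ω.1 (freqWeight ω.1) ω.2 j‖) := by
  have key : ∀ ξ : ℝ, ∃ s e : ℝ, s = ξ * e ∧ e = freqWeight ξ ∧ |s| ≤ 1 ∧ |e| ≤ 1 ∧ |s ^ 2| ≤ 1 ∧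
      |e ^ 2| ≤ 1 := fun ξ => by
    have h1 := abs_mul_freqWeight_le_one ξ
    have h2 : |freqWeight ξ| ≤ 1 := by
      rw [abs_of_pos (freqWeight_pos ξ)]; exact freqWeight_le_one ξ
    refine ⟨_, _, rfl, rfl, h1, h2, ?_, ?_⟩
    · rw [abs_pow]; exact pow_le_one₀ (abs_nonneg _) h1
    · rw [abs_pow]; exact pow_le_one₀ (abs_nonneg _) h2
  have hle : ∀ (r : ℝ) {t : ℝ}, |t| ≤ 1 → |r * t| ≤ |r| := fun r {t} ht => by
    rw [abs_mul]; exact mul_le_of_le_one_right (abs_nonneg _) ht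
  interval_cases i
  · refine ⟨k₄, |k₄| + |γ| + |-k₅|, hk₄, by positivity, fun ⟨ξ, x⟩ => ?_⟩
    obtain ⟨s, e, hs, he, h1, h2, h3, h4⟩ := key ξ
    simp only [← he]
    rw [flowDeriv_crossOp_zero, ← hs]
    set a := chainVar k₂ k₃ ξ e x
    have q1 := mul_norm_sq_le a (i := 0) (hle k₄ h3) 1 3 (by simp) (by simp)
    have q2 := mul_re_mul_conj_le a (i := 2) (j := 0) (le_refl |γ|) 1 3 (by simp) 1 (by simp)
    have q3 := mul_re_mul_conj_le a (i := 1) (j := 0) (hle (-k₅) h2) 1 3 (by simp)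
      Complex.I (by simp)
    rw [one_mul] at q2
    linarith
  · refine ⟨γ, |γ| + |-k₁| + |-k₄|, hγ, by positivity, fun ⟨ξ, x⟩ => ?_⟩
    obtain ⟨s, e, hs, he, h1, h2, h3, h4⟩ := key ξ
    simp only [← he]
    rw [flowDeriv_crossOp_one, ← hs]
    set a := chainVar k₂ k₃ ξ e x
    have q1 := mul_norm_sq_le a (i := 1) (hle γ h3) 2 4 (by simp) (by simp)
    have q2 := mul_re_mul_conj_le a (i := 3) (j := 1) (le_refl |-k₁|) 2 4 (by simp) 1 (by simp)
    have q3 := mul_re_mul_conj_le a (i := 2) (j := 0) (hle (-k₄) h3) 2 4 (by simp) 1 (by simp)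
    rw [one_mul] at q2 q3
    linarith
  · refine ⟨k₁, 1 + |γ| + |-1|, hk₁, by positivity, fun ⟨ξ, x⟩ => ?_⟩
    obtain ⟨s, e, hs, he, h1, h2, h3, h4⟩ := key ξ
    simp only [← he]
    rw [flowDeriv_crossOp_two, ← hs]
    set a := chainVar k₂ k₃ ξ e x
    have q1 := mul_norm_sq_le a (i := 2) h3 3 5 (by simp) (by simp)
    have q2 := mul_re_mul_conj_le a (i := 3) (j := 1) (hle γ h3) 3 5 (by simp) 1 (by simp)
    have q3 := mul_re_mul_conj_le a (i := 4) (j := 2) (le_refl |(-1 : ℝ)|) 3 5 (by simp)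
      Complex.I (by simp)
    rw [one_mul] at q2
    linarith
  · refine ⟨1, |2 * k₁| + 1 + 1, one_pos, by positivity, fun ⟨ξ, x⟩ => ?_⟩
    obtain ⟨s, e, hs, he, h1, h2, h3, h4⟩ := key ξ
    simp only [← he]
    rw [flowDeriv_crossOp_three, ← hs]
    set a := chainVar k₂ k₃ ξ e x
    have q1 := mul_norm_sq_le a (i := 3) (hle (2 * k₁) h4) 4 6 (by simp) (by simp)
    have q2 := mul_re_mul_conj_le a (i := 2) (j := 4) ((abs_neg (s ^ 2)).trans_le h3) 4 6
      (by simp) Complex.I (by simp)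
    have q3 := mul_re_mul_conj_le a (i := 3) (j := 5) h1 4 6 (by simp) Complex.I (by simp)
    linarith
  · refine ⟨1 / 2, |(k₂ + k₃) / 4| + |-γ| + |(k₂ + k₃) / 2| + |(k₂ - k₃) / 2| + |(k₂ - k₃) / 4|,
      by norm_num, by positivity, fun ⟨ξ, x⟩ => ?_⟩
    obtain ⟨s, e, hs, he, h1, h2, h3, h4⟩ := key ξ
    simp only [← he]
    rw [flowDeriv_crossOp_four, ← hs]
    set a := chainVar k₂ k₃ ξ e x
    have h5 : |-γ * s * e ^ 2| ≤ |-γ| := by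
      rw [mul_assoc]
      refine hle _ ?_
      rw [abs_mul]
      exact mul_le_one₀ h1 (abs_nonneg _) h4
    have h6 : ∀ r, |-(e ^ 2 * r)| ≤ |r| := fun r => by
      rw [abs_neg, mul_comm]; exact hle r h4
    have q1 := mul_norm_sq_le a (i := 4) (le_refl |(k₂ + k₃) / 4|) 5 7 (by simp) (by simp)
    have q2 := mul_re_mul_conj_le a (i := 1) (j := 5) h5 5 7 (by simp) Complex.I (by simp)
    have q3 := mul_re_mul_conj_le a (i := 2) (j := 4) (h6 ((k₂ + k₃) / 2)) 5 7 (by simp)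
      Complex.I (by simp)
    have q4 := mul_re_mul_conj_le a (i := 2) (j := 6) (h6 ((k₂ - k₃) / 2)) 5 7 (by simp)
      Complex.I (by simp)
    have q5 := mul_re_mul_conj_le a (i := 4) (j := 6) (le_refl |(k₂ - k₃) / 4|) 5 7 (by simp)
      1 (by simp)
    rw [one_mul] at q5
    linarith
  · refine ⟨(k₂ - k₃) ^ 2 / 2, |k₂ - k₃| + |-((k₂ - k₃) * ((k₂ + k₃) / 2))|, ?_, by positivity,
      fun ⟨ξ, x⟩ => ?_⟩
    · have := sub_ne_zero.2 hk
      positivity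
    simp only
    rw [flowDeriv_crossOp_five]
    set a := chainVar k₂ k₃ ξ (freqWeight ξ) x
    have q1 := mul_re_mul_conj_le a (i := 7) (j := 5) (le_refl |k₂ - k₃|) 6 8 (by simp) 1 (by simp)
    have q2 := mul_re_mul_conj_le a (i := 4) (j := 6)
      (le_refl |-((k₂ - k₃) * ((k₂ + k₃) / 2))|) 6 8 (by simp) 1 (by simp)
    rw [one_mul] at q1 q2
    linarith
  · refine ⟨1, |(k₂ + k₃) / 2| + |(k₂ - k₃) / 2|, one_pos, by positivity, fun ⟨ξ, x⟩ => ?_⟩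
    simp only
    rw [flowDeriv_crossOp_six]
    set a := chainVar k₂ k₃ ξ (freqWeight ξ) x
    have q1 := mul_norm_sq_le a (i := 6) (le_refl |(k₂ + k₃) / 2|) 7 9 (by simp) (by simp)
    have q2 := mul_re_mul_conj_le a (i := 4) (j := 6) (le_refl |(k₂ - k₃) / 2|) 7 9 (by simp)
      1 (by simp)
    rw [one_mul] at q2
    linarith

/-! ### Continuity and boundedness of the cross operators -/

theorem rankOneOp_ofReal_mul (t : ℝ) (c : ℂ) (a b : Fin 8 → ℝ) :
    rankOneOp (t * c) a b = (t : ℂ) • rankOneOp c a b := by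
  rw [rankOneOp, rankOneOp, ← map_smul]
  congr 1
  ext i j
  simp [mul_assoc]

theorem continuous_freqWeight : Continuous freqWeight := by
  unfold freqWeight
  exact Continuous.inv₀ (by fun_prop) fun ξ => by positivity

theorem continuous_rankOneOp {t : ℝ → ℝ} (ht : Continuous t) (c : ℂ) (a b : Fin 8 → ℝ) :
    Continuous fun ξ => rankOneOp (t ξ * c) a b := by
  simp only [rankOneOp_ofReal_mul]
  fun_prop

theorem continuous_crossOp (k₂ k₃ : ℝ) (i : ℕ) :
    Continuous fun ξ => crossOp k₂ k₃ ξ (freqWeight ξ) i := by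
  have hw := continuous_freqWeight
  have h1 : ∀ (t : ℝ → ℝ) (a b : Fin 8 → ℝ), Continuous t →
      Continuous fun ξ => rankOneOp (t ξ : ℂ) a b := fun t a b ht => by
    simpa using continuous_rankOneOp ht 1 a b
  match i with
  | 0 => exact continuous_rankOneOp (by fun_prop) _ _ _
  | 1 => exact continuous_rankOneOp (by fun_prop) _ _ _
  | 2 => exact continuous_rankOneOp (by fun_prop) _ _ _
  | 3 => exact h1 _ _ _ (by fun_prop)
  | 4 => exact (h1 _ _ _ (by fun_prop)).add (continuous_rankOneOp (by fun_prop) _ _ _)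
  | 5 => exact continuous_rankOneOp (by fun_prop) _ _ _
  | 6 => exact continuous_rankOneOp (by fun_prop) _ _ _
  | n + 7 => exact continuous_const

theorem norm_rankOneOp_le {t T : ℝ} (ht : |t| ≤ T) (c : ℂ) (a b : Fin 8 → ℝ) :
    ‖rankOneOp (t * c) a b‖ ≤ T * ‖rankOneOp c a b‖ := by
  rw [rankOneOp_ofReal_mul, norm_smul, Complex.norm_real, Real.norm_eq_abs]
  gcongr

theorem abs_pow_mul_freqWeight_pow_le_one (ξ : ℝ) (m n : ℕ) :
    |ξ ^ m * freqWeight ξ ^ (m + n)| ≤ 1 := by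
  rw [pow_add, ← mul_assoc, ← mul_pow, abs_mul, abs_pow, abs_pow]
  refine mul_le_one₀ (pow_le_one₀ (abs_nonneg _) (abs_mul_freqWeight_le_one ξ)) (by positivity)
    (pow_le_one₀ (abs_nonneg _) ?_)
  rw [abs_of_pos (freqWeight_pos ξ)]
  exact freqWeight_le_one ξ

theorem exists_norm_crossOp_le (k₂ k₃ : ℝ) (i : ℕ) :
    ∃ C : ℝ, 0 ≤ C ∧ ∀ ξ, ‖crossOp k₂ k₃ ξ (freqWeight ξ) i‖ ≤ C := by
  have h0 := abs_pow_mul_freqWeight_pow_le_one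
  have h1 : ∀ {t T : ℝ}, |t| ≤ T → ∀ a b : Fin 8 → ℝ,
      ‖rankOneOp (t : ℂ) a b‖ ≤ T * ‖rankOneOp 1 a b‖ := fun ht a b => by
    simpa using norm_rankOneOp_le ht 1 a b
  have hT : ∀ {T : ℝ} {f : ℝ → StateC →L[ℂ] StateC}, (∀ ξ, ‖f ξ‖ ≤ T) →
      ∃ C : ℝ, 0 ≤ C ∧ ∀ ξ, ‖f ξ‖ ≤ C := fun {T f} h => ⟨T, (norm_nonneg _).trans (h 0), h⟩
  match i with
  | 0 => exact hT fun ξ => norm_rankOneOp_le (by simpa using h0 ξ 1 1) _ _ _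
  | 1 => exact hT fun ξ => norm_rankOneOp_le (h0 ξ 3 1) _ _ _
  | 2 => exact hT fun ξ => norm_rankOneOp_le ((abs_neg _).trans_le (h0 ξ 5 1)) _ _ _
  | 3 => exact hT fun ξ => h1 ((abs_neg _).trans_le (h0 ξ 6 2)) _ _
  | 4 =>
    refine hT fun ξ => (norm_add_le _ _).trans (add_le_add (h1 (h0 ξ 4 4) _ _)
      (norm_rankOneOp_le (T := 1) ?_ _ _ _))
    rw [abs_div, abs_two]
    linarith [h0 ξ 5 3]
  | 5 =>
    refine hT fun ξ => norm_rankOneOp_le (T := |k₂ - k₃|) ?_ _ _ _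
    rw [abs_neg, abs_mul]
    exact mul_le_of_le_one_right (abs_nonneg _) (h0 ξ 5 3)
  | 6 => exact hT fun ξ => norm_rankOneOp_le ((abs_neg _).trans_le (h0 ξ 5 3)) _ _ _
  | n + 7 => exact hT fun ξ => (norm_zero).le

/-! ### Damping rate, energy and Lyapunov functional -/

/-- The rate at which the Fourier mode of frequency `ξ` is damped. -/
noncomputable def dampingRate (ξ : ℝ) : ℝ := ξ ^ 6 * freqWeight ξ ^ 8

/-- The smallest weight in the chain is `(ξ * e) ^ 3 * e`, whose square is the damping rate. The
parallelogram law recovers `y`, `θ` and `k₂ z`, `k₃ φ` from their sums and differences. -/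
theorem dampingRate_le_sum_chainVar {k₂ k₃ : ℝ} (hk₂ : 0 < k₂) (hk₃ : 0 < k₃) :
    ∃ c : ℝ, 0 < c ∧ ∀ (ξ : ℝ) (x : StateC), c * dampingRate ξ * ‖x‖ ^ 2 ≤
      ∑ j ∈ Finset.range 8, ‖chainVar k₂ k₃ ξ (freqWeight ξ) x j‖ ^ 2 := by
  refine ⟨min 1 (min (k₂ ^ 2) (k₃ ^ 2)), by positivity, fun ξ x => ?_⟩
  have hs := abs_mul_freqWeight_le_one ξ
  have hw0 := freqWeight_pos ξ
  have hw := freqWeight_le_one ξ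
  set e := freqWeight ξ with he
  set c := min 1 (min (k₂ ^ 2) (k₃ ^ 2)) with hc
  have hc0 : 0 < c := by positivity
  have hc1 : c ≤ 1 := min_le_left _ _
  have hc2 : c ≤ k₂ ^ 2 := (min_le_right _ _).trans (min_le_left _ _)
  have hc3 : c ≤ k₃ ^ 2 := (min_le_right _ _).trans (min_le_right _ _)
  have hρ : dampingRate ξ = (ξ * e) ^ 6 * e ^ 2 := by rw [dampingRate]; ring
  set s := ξ * e with hs'
  have hs2 : s ^ 2 ≤ 1 := by rw [← sq_abs]; exact pow_le_one₀ (abs_nonneg _) hs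
  have he2 : e ^ 2 ≤ 1 := pow_le_one₀ hw0.le hw
  have h0 : 0 ≤ s ^ 2 := sq_nonneg s
  have he0 : 0 ≤ e ^ 2 := sq_nonneg e
  have par : ∀ z w : ℂ, ‖z + w‖ ^ 2 + ‖z - w‖ ^ 2 = 2 * (‖z‖ ^ 2 + ‖w‖ ^ 2) := fun z w => by
    have := parallelogram_law_with_norm ℝ z w
    linarith
  have p1 := par (x 3) (x 5)
  have p2 := par (k₂ * x 2) (k₃ * x 4)
  have hn : ∀ (r : ℝ) (z : ℂ), ‖(r : ℂ) * z‖ ^ 2 = r ^ 2 * ‖z‖ ^ 2 := fun r z => by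
    rw [norm_mul, mul_pow, Complex.norm_real, Real.norm_eq_abs, sq_abs]
  rw [hn, hn] at p2
  rw [EuclideanSpace.norm_sq_eq, Fin.sum_univ_eight, hρ]
  simp only [Finset.sum_range_succ, Finset.sum_range_zero, chainVar, hn]
  have hA : 0 ≤ s ^ 6 * e ^ 2 := by positivity
  have e3 : s ^ 6 * e ^ 2 ≤ (s ^ 3) ^ 2 := by
    rw [← pow_mul]; exact mul_le_of_le_one_right (by positivity) he2
  have e2 : (s ^ 3) ^ 2 ≤ (s ^ 2) ^ 2 := by
    calc (s ^ 3) ^ 2 = (s ^ 2) ^ 2 * s ^ 2 := by ring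
      _ ≤ (s ^ 2) ^ 2 := mul_le_of_le_one_right (by positivity) hs2
  have e1 : (s ^ 2) ^ 2 ≤ s ^ 2 := by
    rw [sq (s ^ 2)]; exact mul_le_of_le_one_right h0 hs2
  have f0 : c * (s ^ 6 * e ^ 2) ≤ 1 := mul_le_one₀ hc1 hA (by linarith)
  have f : c * (s ^ 6 * e ^ 2) ≤ s ^ 6 * e ^ 2 := mul_le_of_le_one_left hA hc1
  have g2 : c * (s ^ 6 * e ^ 2) ≤ (s ^ 6 * e ^ 2) * k₂ ^ 2 := by
    rw [mul_comm]; exact mul_le_mul_of_nonneg_left hc2 hA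
  have g3 : c * (s ^ 6 * e ^ 2) ≤ (s ^ 6 * e ^ 2) * k₃ ^ 2 := by
    rw [mul_comm]; exact mul_le_mul_of_nonneg_left hc3 hA
  have hB : (s ^ 3 * e) ^ 2 = s ^ 6 * e ^ 2 := by ring
  rw [hB]
  have i7 := mul_le_mul_of_nonneg_right f0 (sq_nonneg ‖x 7‖)
  have i6 := mul_le_mul_of_nonneg_right (f.trans (e3.trans (e2.trans e1))) (sq_nonneg ‖x 6‖)
  have i1 := mul_le_mul_of_nonneg_right (f.trans (e3.trans e2)) (sq_nonneg ‖x 1‖)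
  have i0 := mul_le_mul_of_nonneg_right (f.trans e3) (sq_nonneg ‖x 0‖)
  have i3 := mul_le_mul_of_nonneg_right f (sq_nonneg ‖x 3‖)
  have i5 := mul_le_mul_of_nonneg_right f (sq_nonneg ‖x 5‖)
  have i2 := mul_le_mul_of_nonneg_right g2 (sq_nonneg ‖x 2‖)
  have i4 := mul_le_mul_of_nonneg_right g3 (sq_nonneg ‖x 4‖)
  have n3 := mul_nonneg hA (sq_nonneg ‖x 3‖)
  have n5 := mul_nonneg hA (sq_nonneg ‖x 5‖)
  have n2 := mul_nonneg (mul_nonneg hA (sq_nonneg k₂)) (sq_nonneg ‖x 2‖)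
  have n4 := mul_nonneg (mul_nonneg hA (sq_nonneg k₃)) (sq_nonneg ‖x 4‖)
  have p1' : s ^ 6 * e ^ 2 * ‖x 3 + x 5‖ ^ 2 + s ^ 6 * e ^ 2 * ‖x 3 - x 5‖ ^ 2 =
      2 * (s ^ 6 * e ^ 2 * ‖x 3‖ ^ 2 + s ^ 6 * e ^ 2 * ‖x 5‖ ^ 2) := by
    linear_combination (s ^ 6 * e ^ 2) * p1
  have p2' : s ^ 6 * e ^ 2 * ‖(k₂ : ℂ) * x 2 + k₃ * x 4‖ ^ 2
        + s ^ 6 * e ^ 2 * ‖(k₂ : ℂ) * x 2 - k₃ * x 4‖ ^ 2 =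
      2 * (s ^ 6 * e ^ 2 * k₂ ^ 2 * ‖x 2‖ ^ 2 + s ^ 6 * e ^ 2 * k₃ ^ 2 * ‖x 4‖ ^ 2) := by
    linear_combination (s ^ 6 * e ^ 2) * p2
  linarith

/-- The operator of the physical energy. -/
noncomputable def energyOp (k₁ k₂ k₃ : ℝ) : StateC →L[ℂ] StateC :=
  Matrix.toEuclideanCLM (𝕜 := ℂ) (Matrix.diagonal ![(k₁ : ℂ), 1, k₂, 1, k₃, 1, 1, 1])

theorem energyOp_apply (k₁ k₂ k₃ : ℝ) (x : StateC) :
    (energyOp k₁ k₂ k₃ x).ofLp =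
      ![k₁ * x 0, x 1, k₂ * x 2, x 3, k₃ * x 4, x 5, x 6, x 7] := by
  funext i
  fin_cases i <;> simp [energyOp, Matrix.mulVec_diagonal]

theorem re_inner_energyOp (k₁ k₂ k₃ : ℝ) (x : StateC) :
    (inner ℂ (energyOp k₁ k₂ k₃ x) x).re = k₁ * ‖x 0‖ ^ 2 + ‖x 1‖ ^ 2 + k₂ * ‖x 2‖ ^ 2 + ‖x 3‖ ^ 2
      + k₃ * ‖x 4‖ ^ 2 + ‖x 5‖ ^ 2 + ‖x 6‖ ^ 2 + ‖x 7‖ ^ 2 := by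
  simp only [PiLp.inner_apply, energyOp_apply, Fin.sum_univ_eight, ← Complex.normSq_eq_norm_sq,
    RCLike.inner_apply]
  simp [Complex.normSq_apply]
  ring

/-- The energy weights make the transport part symmetric and the coupling through `k₁` skew, so only
the relaxation of `q` survives. -/
theorem flowDeriv_energyOp (k₁ k₂ k₃ k₄ k₅ γ ξ : ℝ) (x : StateC) :
    flowDeriv (cattaneoSymbol k₁ k₂ k₃ k₄ k₅ γ ξ) (energyOp k₁ k₂ k₃) x =
      -(2 * k₅) * ‖x 7‖ ^ 2 := by
  simp only [flowDeriv, PiLp.inner_apply, energyOp_apply, cattaneoSymbol_apply,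
    Fin.sum_univ_eight, ← Complex.normSq_eq_norm_sq]
  simp [Complex.normSq_apply]
  ring

theorem le_re_inner_energyOp {k₁ k₂ k₃ : ℝ} (hk₁ : 0 < k₁) (hk₂ : 0 < k₂) (hk₃ : 0 < k₃) :
    ∃ c : ℝ, 0 < c ∧ ∀ x : StateC, c * ‖x‖ ^ 2 ≤ (inner ℂ (energyOp k₁ k₂ k₃ x) x).re := by
  refine ⟨min 1 (min k₁ (min k₂ k₃)), by positivity, fun x => ?_⟩
  rw [re_inner_energyOp, EuclideanSpace.norm_sq_eq, Fin.sum_univ_eight]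
  set c := min 1 (min k₁ (min k₂ k₃)) with hc
  have h0 : c ≤ 1 := by simp [hc]
  have h1 : c ≤ k₁ := by simp [hc]
  have h2 : c ≤ k₂ := by simp [hc]
  have h3 : c ≤ k₃ := by simp [hc]
  have h : ∀ {b : ℝ}, c ≤ b → ∀ i, c * ‖x i‖ ^ 2 ≤ b * ‖x i‖ ^ 2 := fun hb i => by gcongr
  linarith [h h1 0, h h0 1, h h2 2, h h0 3, h h3 4, h h0 5, h h0 6, h h0 7]

theorem flowDeriv_add (M K K' : StateC →L[ℂ] StateC) (x : StateC) :
    flowDeriv M (K + K') x = flowDeriv M K x + flowDeriv M K' x := by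
  simp only [flowDeriv, add_apply, inner_add_left, Complex.add_re]
  ring

theorem flowDeriv_ofReal_smul (M K : StateC →L[ℂ] StateC) (r : ℝ) (x : StateC) :
    flowDeriv M ((r : ℂ) • K) x = r * flowDeriv M K x := by
  simp [flowDeriv]
  ring

theorem flowDeriv_sum (M : StateC →L[ℂ] StateC) (K : ℕ → StateC →L[ℂ] StateC) (n : ℕ)
    (x : StateC) : flowDeriv M (∑ i ∈ Finset.range n, K i) x
      = ∑ i ∈ Finset.range n, flowDeriv M (K i) x := by
  induction n with
  | zero => simp [flowDeriv]
  | succ n ih => rw [Finset.sum_range_succ, flowDeriv_add, ih, Finset.sum_range_succ]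

/-- A Lyapunov functional for the Fourier modes of the Cattaneo system, uniform in the
frequency. -/
theorem exists_lyapunov {k₁ k₂ k₃ k₄ k₅ γ : ℝ}
    (hk₁ : 0 < k₁) (hk₂ : 0 < k₂) (hk₃ : 0 < k₃) (hk₄ : 0 < k₄) (hk₅ : 0 < k₅) (hγ : 0 < γ)
    (hk : k₂ ≠ k₃) :
    ∃ (P : ℝ → StateC →L[ℂ] StateC) (c C κ : ℝ), 0 < c ∧ 0 < κ ∧ Continuous P ∧
      (∀ ξ, ‖P ξ‖ ≤ C) ∧ (∀ ξ x, c * ‖x‖ ^ 2 ≤ (inner ℂ (P ξ x) x).re) ∧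
      ∀ ξ x, flowDeriv (cattaneoSymbol k₁ k₂ k₃ k₄ k₅ γ ξ) (P ξ) x ≤
        -κ * dampingRate ξ * ‖x‖ ^ 2 := by
  -- With all seven links used, the leftover `ε`-term involves the eighth variable, which is zero by
  -- definition.
  obtain ⟨a, B, hB, hab⟩ := exists_chain_combination
    (fun i (ω : ℝ × StateC) => ‖chainVar k₂ k₃ ω.1 (freqWeight ω.1) ω.2 i‖)
    (fun i ω => flowDeriv (cattaneoSymbol k₁ k₂ k₃ k₄ k₅ γ ω.1)
      (crossOp k₂ k₃ ω.1 (freqWeight ω.1) i) ω.2) 7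
    (fun i hi => flowDeriv_crossOp_le hk₁ hk₄ hγ hk i hi) 7 le_rfl 1 1 one_pos one_pos
  obtain ⟨κ, hκ, hdamp⟩ := dampingRate_le_sum_chainVar hk₂ hk₃
  obtain ⟨c, hc, hE⟩ := le_re_inner_energyOp hk₁ hk₂ hk₃
  choose T hT0 hT using exists_norm_crossOp_le k₂ k₃
  set S := ∑ i ∈ Finset.range 7, |a i| * T i with hS
  have hS0 : 0 ≤ S := Finset.sum_nonneg fun i _ => mul_nonneg (abs_nonneg _) (hT0 i)
  -- The first summand lets the dissipation of `q` absorb `B * X 0 ^ 2`; the second makes the energy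
  -- dominate the cross terms, with coercivity constant `1`.
  set A := B / (2 * k₅) + (S + 1) / c with hA
  have hA0 : 0 < A := by positivity
  set G : ℝ → StateC →L[ℂ] StateC := fun ξ =>
    ∑ i ∈ Finset.range 7, ((a i : ℝ) : ℂ) • crossOp k₂ k₃ ξ (freqWeight ξ) i with hG
  have hGle : ∀ ξ, ‖G ξ‖ ≤ S := fun ξ => by
    refine (norm_sum_le _ _).trans (Finset.sum_le_sum fun i _ => ?_)
    rw [norm_smul, Complex.norm_real, Real.norm_eq_abs]
    exact mul_le_mul_of_nonneg_left (hT i ξ) (abs_nonneg _)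
  refine ⟨fun ξ => (A : ℂ) • energyOp k₁ k₂ k₃ + G ξ, 1, A * ‖energyOp k₁ k₂ k₃‖ + S, κ, one_pos,
    hκ, ?_, fun ξ => ?_, fun ξ x => ?_, fun ξ x => ?_⟩
  · refine continuous_const.add (continuous_finsetSum _ fun i _ => ?_)
    exact (continuous_const (y := ((a i : ℝ) : ℂ))).smul (continuous_crossOp k₂ k₃ i)
  · refine (norm_add_le _ _).trans (add_le_add ?_ (hGle ξ))
    rw [norm_smul, Complex.norm_real, Real.norm_eq_abs, abs_of_pos hA0]
  · have h1 : |(inner ℂ (G ξ x) x).re| ≤ S * ‖x‖ ^ 2 := by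
      refine (Complex.abs_re_le_norm _).trans ((norm_inner_le_norm _ _).trans ?_)
      rw [sq, ← mul_assoc]
      exact mul_le_mul_of_nonneg_right ((G ξ).le_of_opNorm_le (hGle ξ) x) (norm_nonneg _)
    have h2 : (inner ℂ (((A : ℂ) • energyOp k₁ k₂ k₃ + G ξ) x) x).re
        = A * (inner ℂ (energyOp k₁ k₂ k₃ x) x).re + (inner ℂ (G ξ x) x).re := by
      simp
    rw [h2]
    have h3 := mul_le_mul_of_nonneg_left (hE x) hA0.le
    have h4 : S + 1 ≤ A * c := by
      rw [hA, add_mul, div_mul_cancel₀ _ hc.ne']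
      have : 0 ≤ B / (2 * k₅) * c := by positivity
      linarith
    have h5 := mul_le_mul_of_nonneg_right h4 (sq_nonneg ‖x‖)
    have := neg_le_of_abs_le h1
    linarith
  · have h1 := hab (ξ, x)
    have h2 := hdamp ξ x
    rw [flowDeriv_add, flowDeriv_ofReal_smul, flowDeriv_energyOp, hG, flowDeriv_sum]
    simp only [flowDeriv_ofReal_smul]
    simp only [chainVar, norm_zero] at h1 h2
    have h3 : B ≤ A * (2 * k₅) := by
      rw [hA, add_mul, div_mul_cancel₀ _ (by positivity)]
      have : 0 ≤ (S + 1) / c * (2 * k₅) := by positivity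
      linarith
    have h5 := mul_le_mul_of_nonneg_right h3 (sq_nonneg ‖x 7‖)
    norm_num at h1 h2 ⊢
    linarith

/-! ### From distributional solutions to differentiable curves in frequency space -/

/-- Multiplication by a bounded operator-valued function acts on `L²`. -/
theorem exists_multiplication_operator {L : ℝ → StateC →L[ℂ] StateC} (hL : StronglyMeasurable L)
    {C : ℝ} (hC : ∀ ξ, ‖L ξ‖ ≤ C) :
    ∃ T : L2State →L[ℂ] L2State, ∀ f : L2State, T f =ᵐ[volume] fun ξ => L ξ (f ξ) := by
  have hmem : MemLp L ∞ (volume : Measure ℝ) :=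
    memLp_top_of_bound hL.aestronglyMeasurable C (Filter.Eventually.of_forall hC)
  refine ⟨(ContinuousLinearMap.id ℂ (StateC →L[ℂ] StateC)).holderL volume ∞ 2 2 hmem.toLp,
    fun f => ?_⟩
  rw [ContinuousLinearMap.holderL_apply_apply]
  filter_upwards [(ContinuousLinearMap.id ℂ (StateC →L[ℂ] StateC)).coeFn_holder (r := 2)
    hmem.toLp f, hmem.coeFn_toLp] with ξ h1 h2
  rw [h1, h2]
  rfl

theorem eq_of_toTemperedDistribution_eq {f g : L2State}
    (h : (f : 𝓢'(ℝ, StateC)) = (g : 𝓢'(ℝ, StateC))) : f = g := by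
  have h1 : f - g ∈ (Lp.toTemperedDistributionCLM StateC (volume : Measure ℝ) 2).ker := by
    rw [LinearMap.mem_ker]
    simp [map_sub, h]
  rw [Lp.ker_toTemperedDistributionCLM_eq_bot, Submodule.mem_bot] at h1
  exact sub_eq_zero.1 h1

/-- The pairing of an `L²` function with a fixed Schwartz function. -/
noncomputable def schwartzPairing (g : 𝓢(ℝ, ℂ)) : L2State →L[ℂ] StateC :=
  (PointwiseConvergenceCLM.evalCLM (RingHom.id ℂ) StateC g).comp
    (Lp.toTemperedDistributionCLM StateC (volume : Measure ℝ) 2)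

theorem schwartzPairing_apply (g : 𝓢(ℝ, ℂ)) (f : L2State) :
    schwartzPairing g f = (f : 𝓢'(ℝ, StateC)) g := rfl

/-- A weakly differentiable curve in `L²` with a continuous weak derivative is differentiable. -/
theorem hasDerivWithinAt_of_schwartzPairing {x y : ℝ → L2State}
    (hy : ContinuousOn y (Ici 0))
    (h : ∀ (g : 𝓢(ℝ, ℂ)) (t : ℝ), 0 ≤ t → HasDerivWithinAt (fun s => (x s : 𝓢'(ℝ, StateC)) g)
      ((y t : 𝓢'(ℝ, StateC)) g) (Ici 0) t) (t : ℝ) (ht : 0 ≤ t) :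
    HasDerivWithinAt x (y t) (Ici 0) t := by
  -- Freezing `y` at negative times makes it continuous on the whole line, so its primitive is
  -- differentiable everywhere. That primitive and `x` have the same derivative against each test
  -- function, so they differ by a constant.
  set Y : ℝ → L2State := fun s => y (max s 0) with hY
  have hYc : Continuous Y := by
    refine hy.comp_continuous (by fun_prop) fun s => ?_
    exact le_max_right s 0
  have hYy : ∀ s, 0 ≤ s → Y s = y s := fun s hs => by simp [hY, max_eq_left hs]
  set I : ℝ → L2State := fun t => ∫ s in (0 : ℝ)..t, Y s with hI
  have hId : ∀ s, HasDerivAt I (Y s) s := fun s =>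
    intervalIntegral.integral_hasDerivAt_right (hYc.intervalIntegrable _ _)
      (hYc.stronglyMeasurableAtFilter _ _) hYc.continuousAt
  have hxI : ∀ s, 0 ≤ s → x s = x 0 + I s := fun s hs => by
    have hz : x s - I s = x 0 := by
      refine eq_of_toTemperedDistribution_eq ?_
      ext1 g
      have hder : ∀ r, 0 ≤ r →
          HasDerivWithinAt (fun r => schwartzPairing g (x r - I r)) 0 (Ici 0) r := fun r hr => by
        have h1 := h g r hr
        have h2 := ((schwartzPairing g).restrictScalars ℝ).hasFDerivAt.comp_hasDerivAt r (hId r)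
        have h3 := h1.sub h2.hasDerivWithinAt
        rw [hYy r hr] at h3
        have h4 : (y r : 𝓢'(ℝ, StateC)) g
            - ((schwartzPairing g).restrictScalars ℝ) (y r) = 0 := sub_self _
        rw [h4] at h3
        refine h3.congr_of_mem (fun r _ => ?_) hr
        simp only [map_sub]
        rfl
      have hconst := constant_of_has_deriv_right_zero (a := 0) (b := s)
        (f := fun r => schwartzPairing g (x r - I r))
        (fun r hr => ((hder r hr.1).continuousWithinAt).mono Icc_subset_Ici_self)
        (fun r hr => (hder r hr.1).mono (Ici_subset_Ici.2 hr.1)) s (right_mem_Icc.2 hs)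
      have hI0 : I 0 = 0 := by simp [hI]
      simpa [hI0, schwartzPairing_apply] using hconst
    rw [← hz]; abel
  have h5 : HasDerivWithinAt (fun s => x 0 + I s) (y t) (Ici 0) t := by
    rw [← hYy t ht]
    exact ((hId t).const_add (x 0)).hasDerivWithinAt
  exact h5.congr_of_mem (fun s hs => hxI s hs) ht

theorem re_inner_eq_integral (f g : L2State) :
    (inner ℂ f g).re = ∫ ξ, (inner ℂ (f ξ) (g ξ)).re := by
  rw [L2.inner_def]
  exact (integral_re (L2.integrable_inner (𝕜 := ℂ) f g)).symm

theorem integrable_re_inner (f g : L2State) :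
    Integrable (fun ξ => (inner ℂ (f ξ) (g ξ)).re) volume :=
  (L2.integrable_inner (𝕜 := ℂ) f g).re

/-- Decay of a quadratic form along a curve in `L²` whose Fourier modes solve `x' = M x`. -/
theorem setIntegral_norm_sq_le_exp {x y : ℝ → L2State}
    {M P : ℝ → StateC →L[ℂ] StateC} {c C r : ℝ}
    (hxy : ∀ t, 0 ≤ t → HasDerivWithinAt x (y t) (Ici 0) t)
    (hy : ∀ t, 0 ≤ t → y t =ᵐ[volume] fun ξ => M ξ (x t ξ))
    (hPm : StronglyMeasurable P) (hPC : ∀ ξ, ‖P ξ‖ ≤ C)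
    (hPc : ∀ ξ w, c * ‖w‖ ^ 2 ≤ (inner ℂ (P ξ w) w).re)
    {B : Set ℝ} (hB : MeasurableSet B)
    (hflow : ∀ ξ ∈ B, ∀ w, flowDeriv (M ξ) (P ξ) w ≤ -r * (inner ℂ (P ξ w) w).re)
    {t : ℝ} (ht : 0 ≤ t) :
    ∫ ξ in B, c * ‖x t ξ‖ ^ 2 ≤ ∫ ξ in B, C * Real.exp (-r * t) * ‖x 0 ξ‖ ^ 2 := by
  have hsq : ∀ s, Integrable (fun ξ => ‖x s ξ‖ ^ 2) volume := fun s =>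
    (Lp.memLp (x s)).integrable_norm_pow two_ne_zero
  have hC0 : 0 ≤ C := (norm_nonneg _).trans (hPC 0)
  -- Cutting `P` off to `B` localises the quadratic form in frequency; since the flow acts
  -- fibrewise, the differential inequality is needed only on `B`.
  set Q : ℝ → StateC →L[ℂ] StateC := B.indicator P with hQ
  have hQC : ∀ ξ, ‖Q ξ‖ ≤ C := fun ξ => (norm_indicator_le_norm_self _ _).trans (hPC ξ)
  obtain ⟨T, hT⟩ := exists_multiplication_operator (hPm.indicator hB) hQC
  set Φ : ℝ → ℝ := fun s => (inner ℂ (T (x s)) (x s)).re with hΦ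
  have hQin : ∀ ξ ∈ B, Q ξ = P ξ := fun ξ h => indicator_of_mem h _
  have hQout : ∀ ξ ∉ B, Q ξ = 0 := fun ξ h => indicator_of_notMem h _
  have hΦint : ∀ s, Φ s = ∫ ξ, (inner ℂ (Q ξ (x s ξ)) (x s ξ)).re := fun s => by
    refine (re_inner_eq_integral _ _).trans (integral_congr_ae ?_)
    filter_upwards [hT (x s)] with ξ h
    rw [h]
  have hΦi : ∀ s, Integrable (fun ξ => (inner ℂ (Q ξ (x s ξ)) (x s ξ)).re) volume := fun s =>
    (integrable_re_inner (T (x s)) (x s)).congr (by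
      filter_upwards [hT (x s)] with ξ h
      rw [h])
  have hder : ∀ s, 0 ≤ s → ∃ d, HasDerivWithinAt Φ d (Ici 0) s ∧ d ≤ -r * Φ s := fun s hs => by
    have h1 := hxy s hs
    have h2 := (T.restrictScalars ℝ).hasFDerivAt.comp_hasDerivWithinAt s h1
    have h3 := h2.inner ℂ h1
    have h4 := Complex.reCLM.hasFDerivAt.comp_hasDerivWithinAt s h3
    refine ⟨_, h4, ?_⟩
    have h5 : ∀ a b : ℂ, Complex.reCLM (a + b) = a.re + b.re := fun a b => by simp
    rw [h5]
    simp only [Function.comp, ContinuousLinearMap.coe_restrictScalars']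
    rw [re_inner_eq_integral, re_inner_eq_integral, hΦint, ← integral_const_mul, ← integral_add
      (integrable_re_inner _ _) (integrable_re_inner _ _)]
    refine integral_mono_ae ((integrable_re_inner _ _).add (integrable_re_inner _ _))
      ((hΦi s).const_mul _) ?_
    filter_upwards [hT (x s), hT (y s), hy s hs] with ξ e1 e2 e3
    simp only [e1, e2, e3]
    by_cases hξ : ξ ∈ B
    · rw [← hQ, hQin ξ hξ, add_comm]
      exact hflow ξ hξ _
    · rw [← hQ, hQout ξ hξ]
      simp
  -- Grönwall's inequality in integrating-factor form.
  have hanti : AntitoneOn (fun s => Real.exp (r * s) * Φ s) (Ici 0) := by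
    have hd : ∀ s, 0 ≤ s → ∃ d, HasDerivWithinAt (fun s => Real.exp (r * s) * Φ s) d (Ici 0) s ∧
        d ≤ 0 := fun s hs => by
      obtain ⟨d, h1, h2⟩ := hder s hs
      have h3 : HasDerivAt (fun s => Real.exp (r * s)) (Real.exp (r * s) * (r * 1)) s :=
        ((hasDerivAt_id s).const_mul r).exp
      refine ⟨_, h3.hasDerivWithinAt.mul h1, ?_⟩
      nlinarith [Real.exp_pos (r * s)]
    refine antitoneOn_of_deriv_nonpos (convex_Ici 0) (fun s hs => ?_) (fun s hs => ?_)
      (fun s hs => ?_)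
    · obtain ⟨d, h1, _⟩ := hd s hs
      exact h1.continuousWithinAt
    · rw [interior_Ici] at hs ⊢
      obtain ⟨d, h1, _⟩ := hd s (le_of_lt hs)
      exact (h1.hasDerivAt (Ici_mem_nhds hs)).differentiableAt.differentiableWithinAt
    · rw [interior_Ici] at hs
      obtain ⟨d, h1, h2⟩ := hd s (le_of_lt hs)
      rw [(h1.hasDerivAt (Ici_mem_nhds hs)).deriv]
      exact h2
  have hend := hanti (mem_Ici.2 le_rfl) (mem_Ici.2 ht) ht
  simp only [mul_zero, Real.exp_zero, one_mul] at hend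
  have hΦt : Φ t ≤ Real.exp (-r * t) * Φ 0 := by
    have h1 : Real.exp (-r * t) * Real.exp (r * t) = 1 := by rw [← Real.exp_add]; simp
    calc Φ t = Real.exp (-r * t) * (Real.exp (r * t) * Φ t) := by rw [← mul_assoc, h1, one_mul]
      _ ≤ _ := by gcongr
  have hlow : ∫ ξ in B, c * ‖x t ξ‖ ^ 2 ≤ Φ t := by
    rw [hΦint, ← integral_indicator hB]
    refine integral_mono (((hsq t).const_mul c).indicator hB) (hΦi t) fun ξ => ?_
    by_cases hξ : ξ ∈ B
    · simp only [indicator_of_mem hξ, hQin ξ hξ]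
      exact hPc ξ _
    · simp [indicator_of_notMem hξ, hQout ξ hξ]
  have hup : Φ 0 ≤ ∫ ξ in B, C * ‖x 0 ξ‖ ^ 2 := by
    rw [hΦint, ← integral_indicator hB]
    refine integral_mono (hΦi 0) (((hsq 0).const_mul C).indicator hB) fun ξ => ?_
    by_cases hξ : ξ ∈ B
    · simp only [indicator_of_mem hξ, hQin ξ hξ]
      refine (Complex.re_le_norm _).trans ((norm_inner_le_norm _ _).trans ?_)
      rw [sq, ← mul_assoc]
      exact mul_le_mul_of_nonneg_right ((P ξ).le_of_opNorm_le (hPC ξ) _) (norm_nonneg _)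
    · simp [indicator_of_notMem hξ, hQout ξ hξ]
  calc _ ≤ Φ t := hlow
    _ ≤ Real.exp (-r * t) * ∫ ξ in B, C * ‖x 0 ξ‖ ^ 2 :=
      hΦt.trans (mul_le_mul_of_nonneg_left hup (Real.exp_pos _).le)
    _ = _ := by
      rw [← integral_const_mul]
      congr 1 with ξ
      ring

theorem integrable_schwartz_smul (g : 𝓢(ℝ, ℂ)) (f : L2State) :
    Integrable (fun ξ => g ξ • f ξ) volume :=
  memLp_one_iff_integrable.1 ((Lp.memLp f).smul (r := 1) (g.memLp 2 volume))

theorem toTemperedDistribution_fourier_apply (f : L2State) (g : 𝓢(ℝ, ℂ)) :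
    ((𝓕 f : L2State) : 𝓢'(ℝ, StateC)) g = (f : 𝓢'(ℝ, StateC)) (𝓕 g) := by
  rw [← Lp.fourier_toTemperedDistribution_eq]
  rfl

theorem toTemperedDistribution_lineDerivOp_apply_fourier (f : L2State) (g : 𝓢(ℝ, ℂ)) :
    (∂_{(1 : ℝ)} (f : 𝓢'(ℝ, StateC))) (𝓕 g) =
      ∫ ξ, g ξ • ((2 * Real.pi * Complex.I * ξ) • (𝓕 f : L2State) ξ) := by
  have hg : (fun ξ : ℝ => ((inner ℝ ξ (1 : ℝ) : ℝ) : ℂ)).HasTemperateGrowth := by fun_prop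
  have h := congrArg (fun u : 𝓢'(ℝ, StateC) => u g)
    (TemperedDistribution.fourier_lineDerivOp_eq (f : 𝓢'(ℝ, StateC)) (1 : ℝ))
  rw [Lp.fourier_toTemperedDistribution_eq] at h
  refine Eq.trans ?_ (h.trans ?_)
  · rfl
  · change (2 * Real.pi * Complex.I) • TemperedDistribution.smulLeftCLM StateC _
      ((𝓕 f : L2State) : 𝓢'(ℝ, StateC)) g = _
    rw [TemperedDistribution.smulLeftCLM_apply_apply, Lp.toTemperedDistribution_apply,
      ← integral_smul]
    congr 1 with ξ
    rw [SchwartzMap.smulLeftCLM_apply_apply hg]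
    simp [smul_smul]
    ring_nf
    simp

/-- A damping weight in frequency space that makes the symbol of the system bounded. -/
noncomputable def symbolCutoff (ξ : ℝ) : ℂ := (((1 + ‖ξ‖ ^ 2) ^ (-1 : ℝ) : ℝ) : ℂ)

theorem hasTemperateGrowth_symbolCutoff : symbolCutoff.HasTemperateGrowth := by
  unfold symbolCutoff
  fun_prop

theorem symbolCutoff_ne_zero (ξ : ℝ) : symbolCutoff ξ ≠ 0 := by
  rw [symbolCutoff, Complex.ofReal_ne_zero]
  positivity

theorem norm_symbolCutoff (ξ : ℝ) : ‖symbolCutoff ξ‖ = (1 + ξ ^ 2)⁻¹ := by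
  rw [symbolCutoff, Complex.norm_real, Real.rpow_neg_one, Real.norm_eq_abs,
    abs_of_nonneg (by positivity), Real.norm_eq_abs, sq_abs]

theorem norm_symbolCutoff_mul_le (ξ : ℝ) : ‖symbolCutoff ξ‖ ≤ 1 ∧ ‖symbolCutoff ξ‖ * |ξ| ≤ 1 := by
  rw [norm_symbolCutoff]
  constructor
  · exact inv_le_one_of_one_le₀ (by nlinarith [sq_nonneg ξ])
  · rw [inv_mul_le_iff₀ (by positivity)]
    nlinarith [sq_nonneg (|ξ| - 1), sq_abs ξ]

section
variable (k₁ k₂ k₃ k₄ k₅ γ : ℝ)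

theorem continuous_cattaneoSymbol : Continuous (cattaneoSymbol k₁ k₂ k₃ k₄ k₅ γ) := by
  unfold cattaneoSymbol
  fun_prop

theorem exists_norm_symbolCutoff_smul_le :
    ∃ C, ∀ ξ : ℝ, ‖symbolCutoff ξ • cattaneoSymbol k₁ k₂ k₃ k₄ k₅ γ (2 * Real.pi * ξ)‖ ≤ C := by
  refine ⟨2 * Real.pi * ‖matAct (cattaneoMatrix₁ k₁ k₂ k₃ k₄ γ 1 0 0)‖
    + ‖matAct (cattaneoMatrix₀ k₁ k₅)‖, fun ξ => ?_⟩
  obtain ⟨h1, h2⟩ := norm_symbolCutoff_mul_le ξ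
  rw [cattaneoSymbol, smul_sub, smul_neg]
  refine (norm_sub_le _ _).trans (add_le_add ?_ ?_)
  · rw [norm_neg, norm_smul, norm_smul, norm_mul, Complex.norm_I, Complex.norm_real,
      Real.norm_eq_abs, abs_mul, abs_of_pos (by positivity), one_mul, ← mul_assoc]
    refine mul_le_mul_of_nonneg_right ?_ (norm_nonneg _)
    nlinarith [Real.pi_pos]
  · rw [norm_smul]
    exact mul_le_of_le_one_left (norm_nonneg _) h1

/-- The Fourier transform of a solution, damped at high frequencies, is differentiable in `L²`. -/
theorem exists_hasDerivWithinAt_fourier {U₀ : L2State} {U : ℝ → L2State}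
    (hU : IsCauchySolution (cattaneoMatrix₁ k₁ k₂ k₃ k₄ γ 1 0 0) (cattaneoMatrix₀ k₁ k₅) U₀ U) :
    ∃ x y : ℝ → L2State,
      (∀ t, x t =ᵐ[volume] fun ξ => symbolCutoff ξ • (𝓕 (U t) : L2State) ξ) ∧
      (∀ t, y t =ᵐ[volume] fun ξ => cattaneoSymbol k₁ k₂ k₃ k₄ k₅ γ (2 * Real.pi * ξ) (x t ξ)) ∧
      ∀ t, 0 ≤ t → HasDerivWithinAt x (y t) (Ici 0) t := by
  have hκ := hasTemperateGrowth_symbolCutoff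
  have hκc : Continuous symbolCutoff := hκ.1.continuous
  have hMc := continuous_cattaneoSymbol k₁ k₂ k₃ k₄ k₅ γ
  obtain ⟨C, hC⟩ := exists_norm_symbolCutoff_smul_le k₁ k₂ k₃ k₄ k₅ γ
  obtain ⟨X, hX⟩ := exists_multiplication_operator
    (L := fun ξ => symbolCutoff ξ • ContinuousLinearMap.id ℂ StateC)
    (Continuous.stronglyMeasurable (by fun_prop)) (C := ‖ContinuousLinearMap.id ℂ StateC‖)
    (fun ξ => by
      rw [norm_smul]
      exact mul_le_of_le_one_left (norm_nonneg _) (norm_symbolCutoff_mul_le ξ).1)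
  obtain ⟨Y, hY⟩ := exists_multiplication_operator
    (L := fun ξ => symbolCutoff ξ • cattaneoSymbol k₁ k₂ k₃ k₄ k₅ γ (2 * Real.pi * ξ))
    (Continuous.stronglyMeasurable (by fun_prop)) hC
  have hF : Continuous (fun f : L2State => (𝓕 f : L2State)) :=
    (Lp.fourierTransformₗᵢ ℝ StateC).continuous
  have hX' : ∀ f, X f =ᵐ[volume] fun ξ => symbolCutoff ξ • f ξ := fun f => by
    filter_upwards [hX f] with ξ h
    rw [h]
    rfl
  refine ⟨fun t => X (𝓕 (U t)), fun t => Y (𝓕 (U t)), fun t => hX' _, fun t => ?_,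
    hasDerivWithinAt_of_schwartzPairing ?_ fun g t ht => ?_⟩
  · filter_upwards [hX' (𝓕 (U t)), hY (𝓕 (U t))] with ξ h1 h2
    rw [h1, h2, map_smul]
    rfl
  · exact (Y.continuous.comp hF).comp_continuousOn hU.continuousOn
  -- The cutoff is moved onto the test function, and the equation is tested with `𝓕 g'`. The Fourier
  -- normalisation turns `∂_x` into `2πiξ`, hence the symbol at `2 * Real.pi * ξ`.
  · set g' := SchwartzMap.smulLeftCLM ℂ symbolCutoff g with hg'
    have hgg : ∀ ξ, g' ξ = symbolCutoff ξ * g ξ := fun ξ => by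
      rw [hg', SchwartzMap.smulLeftCLM_apply_apply hκ, smul_eq_mul]
    have h0 : ∀ s, (X (𝓕 (U s)) : 𝓢'(ℝ, StateC)) g = (U s : 𝓢'(ℝ, StateC)) (𝓕 g') := fun s => by
      rw [← toTemperedDistribution_fourier_apply, Lp.toTemperedDistribution_apply,
        Lp.toTemperedDistribution_apply]
      refine integral_congr_ae ?_
      filter_upwards [hX' (𝓕 (U s))] with ξ h
      rw [h, hgg, smul_smul, mul_comm]
    have h1 := hU.equation (𝓕 g') t ht
    simp only [h0]
    convert h1 using 1
    rw [toTemperedDistribution_lineDerivOp_apply_fourier, ← toTemperedDistribution_fourier_apply,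
      Lp.toTemperedDistribution_apply, Lp.toTemperedDistribution_apply]
    set V : L2State := 𝓕 (U t) with hV
    have hi0 : Integrable (fun ξ => g' ξ • V ξ) volume := integrable_schwartz_smul g' V
    have hi1 : Integrable (fun ξ => g' ξ • ((2 * Real.pi * Complex.I * ξ) • V ξ)) volume := by
      have hid : (fun ξ : ℝ => (2 * Real.pi * Complex.I * ξ : ℂ)).HasTemperateGrowth := by fun_prop
      refine (integrable_schwartz_smul (SchwartzMap.smulLeftCLM ℂ
        (fun ξ : ℝ => (2 * Real.pi * Complex.I * ξ : ℂ)) g') V).congr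
        (Filter.Eventually.of_forall fun ξ => ?_)
      beta_reduce
      rw [SchwartzMap.smulLeftCLM_apply_apply hid, smul_smul, smul_eq_mul, mul_comm]
    rw [← ContinuousLinearMap.integral_comp_comm _ hi1,
      ← ContinuousLinearMap.integral_comp_comm _ hi0, ← integral_neg, ← integral_sub]
    · refine integral_congr_ae ?_
      filter_upwards [hY V] with ξ h
      rw [h, hgg]
      simp only [cattaneoSymbol, map_smul, smul_sub, smul_neg, sub_apply, neg_apply,
        smul_apply, smul_smul]
      congr 2
      · congr 1
        push_cast
        ring
      · rw [mul_comm]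
    · exact (ContinuousLinearMap.integrable_comp _ hi1).neg
    · exact ContinuousLinearMap.integrable_comp _ hi0

end

/-! ### Exponential decay of almost every Fourier mode -/

open scoped ContDiff

theorem dampingRate_mem_Ioc {ξ : ℝ} (hξ : ξ ≠ 0) : dampingRate ξ ∈ Ioc (0 : ℝ) 1 := by
  have h := freqWeight_pos ξ
  constructor
  · unfold dampingRate
    positivity
  · exact (le_abs_self _).trans (abs_pow_mul_freqWeight_pow_le_one ξ 6 2)

/-- Every Fourier mode of a solution decays exponentially, at a rate comparable to
`dampingRate`. -/
theorem exists_fourier_decay {k₁ k₂ k₃ k₄ k₅ γ : ℝ}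
    (hk₁ : 0 < k₁) (hk₂ : 0 < k₂) (hk₃ : 0 < k₃) (hk₄ : 0 < k₄) (hk₅ : 0 < k₅) (hγ : 0 < γ)
    (hk : k₂ ≠ k₃) : ∃ C b : ℝ, 0 < C ∧ 0 < b ∧ ∀ (U₀ : L2State) (U : ℝ → L2State),
      IsCauchySolution (cattaneoMatrix₁ k₁ k₂ k₃ k₄ γ 1 0 0) (cattaneoMatrix₀ k₁ k₅) U₀ U →
      ∀ t, 0 ≤ t → ∀ᵐ ξ : ℝ, ‖(𝓕 (U t) : L2State) ξ‖ ^ 2 ≤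
        C * Real.exp (-b * dampingRate (2 * Real.pi * ξ) * t) * ‖(𝓕 U₀ : L2State) ξ‖ ^ 2 := by
  obtain ⟨P, c, C', κ, hc, hκ, hPc, hPC', hPlow, hflow⟩ :=
    exists_lyapunov hk₁ hk₂ hk₃ hk₄ hk₅ hγ hk
  set C := |C'| + 1 with hC
  have hC0 : 0 < C := by positivity
  have hPC : ∀ ξ, ‖P ξ‖ ≤ C := fun ξ => by
    have := hPC' ξ
    have := le_abs_self C'
    linarith
  refine ⟨C / c, κ / (2 * C), by positivity, by positivity, fun U₀ U hU t ht => ?_⟩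
  obtain ⟨x, y, hx, hy, hxy⟩ := exists_hasDerivWithinAt_fourier k₁ k₂ k₃ k₄ k₅ γ hU
  have hρc : Continuous fun ξ : ℝ => dampingRate (2 * Real.pi * ξ) := by
    have := continuous_freqWeight
    unfold dampingRate
    fun_prop
  have hsq : ∀ s, Integrable (fun ξ => ‖x s ξ‖ ^ 2) volume := fun s =>
    (Lp.memLp (x s)).integrable_norm_pow two_ne_zero
  -- The integral estimate needs a constant rate, so frequencies are sorted by dyadic lower bounds
  -- on the damping rate. Its validity on every measurable subset makes it an almost everywhere
  -- inequality.
  have hn : ∀ n : ℕ, ∀ᵐ ξ : ℝ, (1 / 2 : ℝ) ^ (n + 1) ≤ dampingRate (2 * Real.pi * ξ) →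
      c * ‖x t ξ‖ ^ 2 ≤ C * Real.exp (-(κ * (1 / 2) ^ (n + 1) / C) * t) * ‖x 0 ξ‖ ^ 2 := fun n => by
    set S : Set ℝ := {ξ | (1 / 2 : ℝ) ^ (n + 1) ≤ dampingRate (2 * Real.pi * ξ)} with hS
    have hSm : MeasurableSet S := (isClosed_le continuous_const hρc).measurableSet
    have h := ae_le_of_forall_setIntegral_le (μ := volume.restrict S)
      (((hsq t).const_mul c).restrict (s := S))
      (((hsq 0).const_mul (C * Real.exp (-(κ * (1 / 2) ^ (n + 1) / C) * t))).restrict (s := S))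
      (fun s hs _ => by
        rw [Measure.restrict_restrict hs]
        refine setIntegral_norm_sq_le_exp hxy (fun s _ => hy s)
          (P := fun ξ => P (2 * Real.pi * ξ)) (Continuous.stronglyMeasurable (by fun_prop))
          (fun ξ => hPC _) (fun ξ w => hPlow _ w) (hs.inter hSm) (fun ξ hξ w => ?_) ht
        have h1 := hflow (2 * Real.pi * ξ) w
        have h2 : (inner ℂ (P (2 * Real.pi * ξ) w) w).re ≤ C * ‖w‖ ^ 2 := by
          refine (Complex.re_le_norm _).trans ((norm_inner_le_norm _ _).trans ?_)
          rw [sq, ← mul_assoc]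
          exact mul_le_mul_of_nonneg_right ((P _).le_of_opNorm_le (hPC _) _) (norm_nonneg _)
        have h3 : (1 / 2 : ℝ) ^ (n + 1) ≤ dampingRate (2 * Real.pi * ξ) := hξ.2
        have h4 : κ * (1 / 2) ^ (n + 1) / C * (inner ℂ (P (2 * Real.pi * ξ) w) w).re ≤
            κ * (1 / 2) ^ (n + 1) * ‖w‖ ^ 2 := by
          calc _ ≤ κ * (1 / 2) ^ (n + 1) / C * (C * ‖w‖ ^ 2) := by gcongr
            _ = _ := by field_simp
        have h5 : κ * (1 / 2) ^ (n + 1) * ‖w‖ ^ 2 ≤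
            κ * dampingRate (2 * Real.pi * ξ) * ‖w‖ ^ 2 := by gcongr
        linarith)
    exact (ae_restrict_iff' hSm).1 h
  have hne : ∀ᵐ ξ : ℝ, ξ ≠ 0 := by simp [ae_iff]
  filter_upwards [ae_all_iff.2 hn, hx t, hx 0, hne] with ξ h h1 h2 h0
  obtain ⟨hρ0, hρ1⟩ := dampingRate_mem_Ioc (ξ := 2 * Real.pi * ξ) (by positivity)
  -- Replacing the rate by its dyadic lower bound loses at most a factor `2`, hence `κ / (2 * C)`.
  obtain ⟨n, hn1, hn2⟩ := exists_nat_pow_near_of_lt_one hρ0 hρ1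
    (by norm_num : (0 : ℝ) < 1 / 2) (by norm_num)
  have h3 := h n hn1.le
  rw [h1, h2, hU.initial, norm_smul, norm_smul, mul_pow, mul_pow] at h3
  set ρ := dampingRate (2 * Real.pi * ξ) with hρ
  -- The cutoff multiplies both sides and never vanishes, so it cancels.
  have hcut : 0 < ‖symbolCutoff ξ‖ ^ 2 := pow_pos (norm_pos_iff.2 (symbolCutoff_ne_zero ξ)) 2
  have h4 : c * ‖(𝓕 (U t) : L2State) ξ‖ ^ 2 ≤
      C * Real.exp (-(κ * (1 / 2) ^ (n + 1) / C) * t) * ‖(𝓕 U₀ : L2State) ξ‖ ^ 2 := by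
    refine le_of_mul_le_mul_left ?_ hcut
    linarith
  have h5 : Real.exp (-(κ * (1 / 2) ^ (n + 1) / C) * t) ≤ Real.exp (-(κ / (2 * C)) * ρ * t) := by
    refine Real.exp_le_exp.2 (mul_le_mul_of_nonneg_right ?_ ht)
    rw [neg_mul, neg_le_neg_iff]
    calc κ / (2 * C) * ρ ≤ κ / (2 * C) * (1 / 2) ^ n := by gcongr
      _ = κ * (1 / 2) ^ (n + 1) / C := by rw [pow_succ]; field_simp
  rw [div_mul_eq_mul_div, div_mul_eq_mul_div, le_div_iff₀ hc, mul_comm _ c]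
  exact h4.trans (by gcongr)

/-! ### Integrable data, derivatives and Sobolev regularity on the Fourier side -/

/-- The Fourier transform of an integrable `L²` function is bounded by its `L¹` norm. -/
theorem norm_fourier_le_integral_norm {f : L2State} (hf : Integrable (fun x => f x) volume) :
    ∀ᵐ ξ : ℝ, ‖(𝓕 f : L2State) ξ‖ ≤ ∫ x, ‖f x‖ := by
  have hc : Continuous (𝓕 (fun x => f x) : ℝ → StateC) :=
    VectorFourier.fourierIntegral_continuous (L := innerₗ ℝ) Real.continuous_fourierChar
      continuous_inner hf
  have h : ∀ᵐ ξ : ℝ, (𝓕 f : L2State) ξ = (𝓕 (fun x => f x) : ℝ → StateC) ξ := by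
    -- The `L²` Fourier transform and the Fourier integral agree against smooth compactly supported
    -- functions, by the self-adjointness of each.
    refine ae_eq_of_integral_contDiff_smul_eq
      ((Lp.memLp (𝓕 f : L2State)).locallyIntegrable (by norm_num)) hc.locallyIntegrable
      fun g g_smooth g_cpt => ?_
    have hg₁ : HasCompactSupport (Complex.ofRealCLM ∘ g) := g_cpt.comp_left rfl
    have hg₂ : ContDiff ℝ ∞ (Complex.ofRealCLM ∘ g) := by fun_prop
    set G : 𝓢(ℝ, ℂ) := hg₁.toSchwartzMap hg₂ with hG
    have hGg : ∀ ξ, G ξ = (g ξ : ℂ) := fun ξ => rfl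
    have h1 := toTemperedDistribution_fourier_apply f G
    rw [Lp.toTemperedDistribution_apply, Lp.toTemperedDistribution_apply] at h1
    have h2 := VectorFourier.integral_fourierIntegral_smul_eq_flip (L := innerₗ ℝ)
      (μ := volume) (ν := volume) Real.continuous_fourierChar continuous_inner (G.integrable) hf
    have h3 : ∀ v : StateC, ∀ ξ, g ξ • v = G ξ • v := fun v ξ => by
      rw [hGg, Complex.coe_smul]
    simp only [h3]
    rw [h1]
    refine h2.trans ?_
    rw [flip_innerₗ]
    rfl
  filter_upwards [h] with ξ h
  rw [h]
  exact VectorFourier.norm_fourierIntegral_le_integral_norm _ _ _ _ _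

theorem fourier_iterate_lineDerivOp (u : 𝓢'(ℝ, StateC)) (n : ℕ) :
    𝓕 (∂_{(1 : ℝ)}^[n] u) = TemperedDistribution.smulLeftCLM StateC
      (fun ξ : ℝ => (2 * Real.pi * Complex.I * ξ) ^ n) (𝓕 u) := by
  induction n with
  | zero => simp
  | succ n ih =>
    have hp : (fun ξ : ℝ => (2 * Real.pi * Complex.I * ξ : ℂ) ^ n).HasTemperateGrowth := by
      fun_prop
    have hi : (fun ξ : ℝ => ((inner ℝ ξ (1 : ℝ) : ℝ) : ℂ)).HasTemperateGrowth := by fun_prop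
    rw [Function.iterate_succ_apply', TemperedDistribution.fourier_lineDerivOp_eq, ih,
      TemperedDistribution.smulLeftCLM_smulLeftCLM_apply hp hi]
    rw [← smul_apply, ← TemperedDistribution.smulLeftCLM_smul (hp.mul hi)]
    congr 2
    funext ξ
    simp [pow_succ]
    ring

/-- A function whose Fourier transform is `(2πiξ)ⁿ` times that of `f` is the `n`-th derivative
of `f`. -/
theorem hasL2Deriv_of_fourier {n : ℕ} {f h : L2State}
    (hfh : (𝓕 h : L2State) =ᵐ[volume]
      fun ξ : ℝ => (2 * Real.pi * Complex.I * ξ) ^ n • (𝓕 f : L2State) ξ) : HasL2Deriv n f h := by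
  have hp : (fun ξ : ℝ => (2 * Real.pi * Complex.I * ξ : ℂ) ^ n).HasTemperateGrowth := by
    fun_prop
  have h1 : 𝓕 (∂_{(1 : ℝ)}^[n] (f : 𝓢'(ℝ, StateC))) = 𝓕 (h : 𝓢'(ℝ, StateC)) := by
    rw [fourier_iterate_lineDerivOp, Lp.fourier_toTemperedDistribution_eq,
      Lp.fourier_toTemperedDistribution_eq]
    ext1 g
    rw [TemperedDistribution.smulLeftCLM_apply_apply, Lp.toTemperedDistribution_apply,
      Lp.toTemperedDistribution_apply]
    refine integral_congr_ae ?_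
    filter_upwards [hfh] with ξ hξ
    rw [hξ, SchwartzMap.smulLeftCLM_apply_apply hp, smul_smul, smul_eq_mul, mul_comm]
  rw [HasL2Deriv, LineDeriv.iteratedLineDerivOp_const_eq_iter_lineDerivOp]
  have h2 := congrArg (fun u : 𝓢'(ℝ, StateC) => 𝓕⁻ u) h1
  simpa using h2

theorem norm_deriv_symbol_pow (ξ : ℝ) (n : ℕ) :
    ‖(2 * Real.pi * Complex.I * ξ : ℂ) ^ n‖ = |2 * Real.pi * ξ| ^ n := by
  rw [norm_pow]
  simp [abs_mul, abs_of_pos Real.pi_pos]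

theorem norm_sq_eq_integral (f : L2State) : ‖f‖ ^ 2 = ∫ ξ, ‖f ξ‖ ^ 2 := by
  have h := re_inner_eq_integral f f
  rw [← RCLike.re_eq_complex_re, inner_self_eq_norm_sq] at h
  rw [h]
  congr 1 with ξ
  exact inner_self_eq_norm_sq _

/-- The Bessel weight `(1 + ξ²)^(n/2)` dominates `|ξ|^n`, so the candidate transform of the
derivative is in `L²` and can be inverted. -/
theorem MemSobolev.exists_fourier_deriv {N n : ℕ} (hn : n ≤ N) {f : L2State}
    (hf : TemperedDistribution.MemSobolev (N : ℝ) 2 (f : 𝓢'(ℝ, StateC))) :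
    ∃ W : L2State, (𝓕 W : L2State) =ᵐ[volume]
      fun ξ : ℝ => (2 * Real.pi * Complex.I * ξ) ^ n • (𝓕 f : L2State) ξ := by
  have hf' := hf.mono (s' := (n : ℝ)) (by exact_mod_cast hn)
  obtain ⟨g, hg⟩ := TemperedDistribution.memSobolev_iff_exists_smulLeftCLM_fourier.1 hf'
  rw [Lp.fourier_toTemperedDistribution_eq] at hg
  have hw : (fun ξ : ℝ => (((1 + ‖ξ‖ ^ 2) ^ ((n : ℝ) / 2) : ℝ) : ℂ)).HasTemperateGrowth := by
    fun_prop
  have hae : ∀ᵐ ξ : ℝ, (((1 + ‖ξ‖ ^ 2) ^ ((n : ℝ) / 2) : ℝ) : ℂ) • (𝓕 f : L2State) ξ = g ξ := by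
    have hloc : LocallyIntegrable (𝓕 f : L2State) volume :=
      (Lp.memLp (𝓕 f : L2State)).locallyIntegrable (by norm_num)
    refine ae_eq_of_integral_contDiff_smul_eq ?_
      ((Lp.memLp g).locallyIntegrable (by norm_num)) fun φ φ_smooth φ_cpt => ?_
    · rw [← locallyIntegrableOn_univ] at hloc ⊢
      exact hloc.continuousOn_smul isOpen_univ.isLocallyClosed hw.1.continuous.continuousOn
    have hg₁ : HasCompactSupport (Complex.ofRealCLM ∘ φ) := φ_cpt.comp_left rfl
    have hg₂ : ContDiff ℝ ∞ (Complex.ofRealCLM ∘ φ) := by fun_prop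
    set G : 𝓢(ℝ, ℂ) := hg₁.toSchwartzMap hg₂ with hG
    have h1 := congrArg (fun u : 𝓢'(ℝ, StateC) => u G) hg
    simp only [TemperedDistribution.smulLeftCLM_apply_apply, Lp.toTemperedDistribution_apply,
      SchwartzMap.smulLeftCLM_apply_apply hw] at h1
    have h3 : ∀ v : StateC, ∀ ξ, φ ξ • v = G ξ • v := fun v ξ => by
      rw [show G ξ = (φ ξ : ℂ) from rfl, Complex.coe_smul]
    simp only [h3]
    rw [← h1]
    congr 1 with ξ
    rw [smul_smul, smul_eq_mul, mul_comm]
  have hcont : Continuous fun ξ : ℝ => (2 * Real.pi * Complex.I * ξ : ℂ) ^ n := by fun_prop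
  have hmem : MemLp (fun ξ : ℝ => (2 * Real.pi * Complex.I * ξ : ℂ) ^ n • (𝓕 f : L2State) ξ) 2
      volume := by
    refine MemLp.of_le_mul (c := (2 * Real.pi) ^ n) (Lp.memLp g)
      (hcont.aestronglyMeasurable.smul (Lp.aestronglyMeasurable _)) ?_
    filter_upwards [hae] with ξ h
    rw [← h, norm_smul, norm_smul, norm_deriv_symbol_pow, Complex.norm_real, Real.norm_eq_abs,
      abs_mul, abs_of_pos (by positivity : (0 : ℝ) < 2 * Real.pi), mul_pow, mul_assoc]
    gcongr
    rw [Real.norm_eq_abs, sq_abs, abs_of_nonneg (by positivity : 0 ≤ (1 + ξ ^ 2) ^ ((n : ℝ) / 2))]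
    calc |ξ| ^ n = (ξ ^ 2) ^ ((n : ℝ) / 2) := by
          rw [← sq_abs, ← Real.rpow_natCast (|ξ|) 2, ← Real.rpow_mul (abs_nonneg _),
            ← Real.rpow_natCast]
          congr 1
          push_cast
          ring
      _ ≤ (1 + ξ ^ 2) ^ ((n : ℝ) / 2) := by gcongr; linarith
  refine ⟨𝓕⁻ (hmem.toLp), ?_⟩
  rw [FourierTransform.fourier_fourierInv_eq]
  exact hmem.coeFn_toLp

/-! ### Low and high frequency bounds -/

theorem dampingRate_eq (η : ℝ) : dampingRate η * (1 + η ^ 2) ^ 4 = η ^ 6 := by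
  calc dampingRate η * (1 + η ^ 2) ^ 4 = η ^ 6 * (freqWeight η ^ 2 * (1 + η ^ 2)) ^ 4 := by
        unfold dampingRate; ring
    _ = η ^ 6 := by rw [freqWeight_sq]; ring

theorem pow_six_div_le_dampingRate {η : ℝ} (hη : η ^ 2 ≤ 1) : η ^ 6 / 16 ≤ dampingRate η := by
  have h0 : 0 ≤ dampingRate η := by
    have := freqWeight_pos η
    unfold dampingRate
    positivity
  rw [← dampingRate_eq, mul_div_assoc]
  refine mul_le_of_le_one_right h0 ?_
  have : (1 + η ^ 2) ^ 4 ≤ 2 ^ 4 := by gcongr; linarith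
  linarith

theorem inv_sq_div_le_dampingRate {η : ℝ} (hη : 1 ≤ η ^ 2) : 1 / (16 * η ^ 2) ≤ dampingRate η := by
  have hpos : 0 < η ^ 2 := by linarith
  have h1 : (1 + η ^ 2) ^ 4 ≤ 16 * η ^ 2 * η ^ 6 := by
    calc (1 + η ^ 2) ^ 4 ≤ (η ^ 2 + η ^ 2) ^ 4 := by gcongr
      _ = 16 * η ^ 2 * η ^ 6 := by ring
  rw [div_le_iff₀ (by positivity), mul_comm]
  have h0 : 0 < (1 + η ^ 2) ^ 4 := by positivity
  refine le_of_mul_le_mul_right ?_ h0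
  calc 1 * (1 + η ^ 2) ^ 4 ≤ 16 * η ^ 2 * η ^ 6 := by rw [one_mul]; exact h1
    _ = _ := by rw [← dampingRate_eq]; ring

theorem exp_neg_mul_le {b y : ℝ} (hb : 0 < b) (hy : 0 < y) (n : ℕ) :
    Real.exp (-(b * y)) ≤ n.factorial / b ^ n * (y⁻¹) ^ n := by
  have h := Real.pow_div_factorial_le_exp (b * y) (by positivity) n
  rw [Real.exp_neg, inv_pow, ← div_eq_mul_inv, div_div, ← mul_pow]
  rw [inv_le_comm₀ (Real.exp_pos _) (by positivity), inv_div]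
  exact h

/-- Splitting of the decay factor into its low and high frequency parts. -/
theorem exists_exp_dampingRate_le {b : ℝ} (hb : 0 < b) (n : ℕ) :
    ∃ K : ℝ, 0 < K ∧ ∀ t η : ℝ, 0 ≤ t → Real.exp (-b * dampingRate η * t) ≤
        K * Real.exp (-(b / 16) * ((1 + t) * η ^ 6)) ∨
      Real.exp (-b * dampingRate η * t) ≤ K * ((1 + t)⁻¹ * η ^ 2) ^ n := by
  have hK : 0 < Real.exp (b / 16) * (n.factorial / (b / 16) ^ n) :=
    mul_pos (Real.exp_pos _) (by positivity)
  refine ⟨Real.exp (b / 16) + Real.exp (b / 16) * (n.factorial / (b / 16) ^ n), by positivity,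
    fun t η ht => ?_⟩
  rcases le_total (η ^ 2) 1 with h | h
  · left
    have h1 := pow_six_div_le_dampingRate h
    have h6 : η ^ 6 ≤ 1 := by
      calc η ^ 6 = (η ^ 2) ^ 3 := by ring
        _ ≤ 1 := pow_le_one₀ (sq_nonneg _) h
    calc Real.exp (-b * dampingRate η * t)
        -- Passing from `t` to `1 + t` costs only `exp (b / 16)`, as `η ^ 6 ≤ 1` here; the high
        -- frequency case uses `(η ^ 2)⁻¹ ≤ 1` likewise.
        ≤ Real.exp (b / 16 + -(b / 16) * ((1 + t) * η ^ 6)) := by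
          refine Real.exp_le_exp.2 ?_
          have h2 := mul_le_mul_of_nonneg_left h1 (mul_nonneg hb.le ht)
          have h3 := mul_le_mul_of_nonneg_left h6 (by positivity : 0 ≤ b / 16)
          nlinarith
      _ = Real.exp (b / 16) * Real.exp (-(b / 16) * ((1 + t) * η ^ 6)) := Real.exp_add _ _
      _ ≤ _ := by gcongr; linarith
  · right
    have hpos : 0 < η ^ 2 := by linarith
    have h1 := inv_sq_div_le_dampingRate h
    have hy : 0 < (1 + t) * (η ^ 2)⁻¹ := by positivity
    calc Real.exp (-b * dampingRate η * t)
        ≤ Real.exp (b / 16 + -(b / 16 * ((1 + t) * (η ^ 2)⁻¹))) := by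
          refine Real.exp_le_exp.2 ?_
          have h2 := mul_le_mul_of_nonneg_left h1 (mul_nonneg hb.le ht)
          have h3 : b / 16 * (η ^ 2)⁻¹ ≤ b / 16 * 1 := by
            gcongr
            exact inv_le_one_of_one_le₀ h
          have h4 : b * t * (1 / (16 * η ^ 2)) = b / 16 * t * (η ^ 2)⁻¹ := by field_simp
          nlinarith
      _ = Real.exp (b / 16) * Real.exp (-(b / 16 * ((1 + t) * (η ^ 2)⁻¹))) := Real.exp_add _ _
      _ ≤ Real.exp (b / 16) * (n.factorial / (b / 16) ^ n * (((1 + t) * (η ^ 2)⁻¹)⁻¹) ^ n) := by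
          gcongr
          exact exp_neg_mul_le (by positivity) hy n
      _ = Real.exp (b / 16) * (n.factorial / (b / 16) ^ n) * ((1 + t)⁻¹ * η ^ 2) ^ n := by
          rw [mul_inv, inv_inv, mul_assoc]
      _ ≤ _ := by
          gcongr
          linarith [Real.exp_pos (b / 16)]

theorem integrable_pow_mul_exp_neg_pow_six {b : ℝ} (hb : 0 < b) (j : ℕ) :
    Integrable fun ξ : ℝ => ξ ^ (2 * j) * Real.exp (-b * ξ ^ 6) := by
  have h := (integrable_rpow_mul_exp_neg_mul_sq hb (s := ((2 * j : ℕ) : ℝ))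
    (by have : (0 : ℝ) ≤ ((2 * j : ℕ) : ℝ) := Nat.cast_nonneg _; linarith)).const_mul (Real.exp b)
  refine h.mono' (by fun_prop) (Filter.Eventually.of_forall fun ξ => ?_)
  have hev : 0 ≤ ξ ^ (2 * j) := by rw [pow_mul]; positivity
  rw [Real.norm_eq_abs, abs_of_nonneg (mul_nonneg hev (Real.exp_pos _).le), Real.rpow_natCast,
    mul_left_comm, ← Real.exp_add]
  refine mul_le_mul_of_nonneg_left (Real.exp_le_exp.2 ?_) hev
  have h6 : ξ ^ 2 ≤ 1 + ξ ^ 6 := by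
    nlinarith [sq_nonneg (ξ ^ 2 - 1), sq_nonneg ξ, mul_nonneg (sq_nonneg ξ) (sq_nonneg (ξ ^ 2 - 1))]
  nlinarith

/-- The substitution `ξ ↦ 2πsξ` gives the exact power of `s`: `2 * j` from the weight and `1` from
the measure. -/
theorem exists_integral_low_frequency {b : ℝ} (hb : 0 < b) (j : ℕ) :
    ∃ G : ℝ, 0 ≤ G ∧ ∀ s : ℝ, 0 < s →
      Integrable (fun ξ : ℝ => (2 * Real.pi * ξ) ^ (2 * j) *
        Real.exp (-b * (s ^ 6 * (2 * Real.pi * ξ) ^ 6))) ∧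
      ∫ ξ : ℝ, (2 * Real.pi * ξ) ^ (2 * j) * Real.exp (-b * (s ^ 6 * (2 * Real.pi * ξ) ^ 6)) =
        G * (s⁻¹) ^ (2 * j + 1) := by
  have hi := integrable_pow_mul_exp_neg_pow_six hb j
  have hpi : 0 < 2 * Real.pi := by positivity
  refine ⟨(2 * Real.pi)⁻¹ * ∫ ξ : ℝ, ξ ^ (2 * j) * Real.exp (-b * ξ ^ 6),
    mul_nonneg (by positivity) (integral_nonneg fun ξ => ?_), fun s hs => ?_⟩
  · rw [pow_mul]; positivity
  have heq : (fun ξ : ℝ => (2 * Real.pi * ξ) ^ (2 * j) *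
        Real.exp (-b * (s ^ 6 * (2 * Real.pi * ξ) ^ 6))) = fun ξ : ℝ => (s⁻¹) ^ (2 * j) *
        ((2 * Real.pi * s * ξ) ^ (2 * j) * Real.exp (-b * (2 * Real.pi * s * ξ) ^ 6)) := by
    funext ξ
    rw [show s ^ 6 * (2 * Real.pi * ξ) ^ 6 = (2 * Real.pi * s * ξ) ^ 6 by ring, ← mul_assoc,
      ← mul_pow, show s⁻¹ * (2 * Real.pi * s * ξ) = 2 * Real.pi * ξ by field_simp]
  rw [heq]
  refine ⟨(hi.comp_mul_left' (by positivity)).const_mul _, ?_⟩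
  rw [integral_const_mul, Measure.integral_comp_mul_left
    (fun ξ : ℝ => ξ ^ (2 * j) * Real.exp (-b * ξ ^ 6)), abs_of_pos (by positivity), smul_eq_mul,
    mul_inv, pow_succ]
  ring

/-! ### The decay estimate -/

theorem sqrt_add_mul_le {A B x y : ℝ} (hA : 0 ≤ A) (hB : 0 ≤ B) (hx : 0 ≤ x) (hy : 0 ≤ y) {v : ℝ}
    (h : v ^ 2 ≤ A * x ^ 2 + B * y ^ 2) : v ≤ √A * x + √B * y := by
  refine le_of_sq_le_sq ?_ (by positivity)
  have h1 := Real.sq_sqrt hA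
  have h2 := Real.sq_sqrt hB
  have h3 : 0 ≤ √A * x * (√B * y) := by positivity
  nlinarith

theorem theorem4p2 (k₁ k₂ k₃ k₄ k₅ γ : ℝ)
    (hk₁ : 0 < k₁) (hk₂ : 0 < k₂) (hk₃ : 0 < k₃) (hk₄ : 0 < k₄) (hk₅ : 0 < k₅) (hγ : 0 < γ)
    (hk : k₂ ≠ k₃) (N ℓ j : ℕ) (hℓ : 1 ≤ ℓ) (hℓN : ℓ ≤ N) (hj : j ≤ N - ℓ) :
    ∃ c₀ : ℝ, 0 < c₀ ∧
      ∀ U₀ : L2State,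
        TemperedDistribution.MemSobolev (N : ℝ) 2 (U₀ : 𝓢'(ℝ, StateC)) →
        Integrable (fun x : ℝ => U₀ x) (volume : Measure ℝ) →
        ∀ U : ℝ → L2State,
          IsCauchySolution (cattaneoMatrix₁ k₁ k₂ k₃ k₄ γ 1 0 0) (cattaneoMatrix₀ k₁ k₅) U₀ U →
          ∃ W : L2State, HasL2Deriv (j + ℓ) U₀ W ∧
            ∀ t : ℝ, 0 ≤ t → ∃ V : L2State, HasL2Deriv j (U t) V ∧
              ‖V‖ ≤ c₀ * (1 + t) ^ (-(1 / 12 : ℝ) - (j : ℝ) / 6) * (∫ x : ℝ, ‖U₀ x‖)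
                + c₀ * (1 + t) ^ (-((ℓ : ℝ) / 2)) * ‖W‖ := by
  obtain ⟨C, b, hC, hb, hdecay⟩ := exists_fourier_decay hk₁ hk₂ hk₃ hk₄ hk₅ hγ hk
  obtain ⟨K, hK, hsplit⟩ := exists_exp_dampingRate_le hb ℓ
  obtain ⟨G, hG, hlow⟩ := exists_integral_low_frequency (b := b / 16) (by positivity) j
  refine ⟨√(C * K * G) + √(C * K), by positivity, fun U₀ hsob hint U hU => ?_⟩
  obtain ⟨W, hW⟩ := MemSobolev.exists_fourier_deriv (n := j + ℓ) (by omega) hsob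
  refine ⟨W, hasL2Deriv_of_fourier hW, fun t ht => ?_⟩
  have ht1 : 0 < 1 + t := by linarith
  set m : ℝ := ∫ x : ℝ, ‖U₀ x‖ with hm
  have hm0 : 0 ≤ m := integral_nonneg fun x => norm_nonneg _
  -- With this `s` the low frequency integral is `G * (1 + t) ^ (-(2 * j + 1) / 6)`; its square root
  -- carries the exponent `-1/12 - j/6`.
  set s : ℝ := (1 + t) ^ (1 / 6 : ℝ) with hs
  have hs0 : 0 < s := Real.rpow_pos_of_pos ht1 _
  have hs6 : s ^ 6 = 1 + t := by
    rw [hs, ← Real.rpow_natCast, ← Real.rpow_mul ht1.le]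
    norm_num
  obtain ⟨hlowi, hloweq⟩ := hlow s hs0
  rw [hs6] at hlowi hloweq
  set F : ℝ → ℝ := fun ξ => C * K * m ^ 2 * ((2 * Real.pi * ξ) ^ (2 * j) *
    Real.exp (-(b / 16) * ((1 + t) * (2 * Real.pi * ξ) ^ 6))) +
    C * K * ((1 + t)⁻¹) ^ ℓ * ‖(𝓕 W : L2State) ξ‖ ^ 2 with hF
  have hWi : Integrable (fun ξ => ‖(𝓕 W : L2State) ξ‖ ^ 2) volume :=
    (Lp.memLp (𝓕 W : L2State)).integrable_norm_pow two_ne_zero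
  have hFi : Integrable F volume := (hlowi.const_mul _).add (hWi.const_mul _)
  -- The integrable majorant `F` serves twice: it shows that the `j`-th derivative lies in `L²`, and
  -- its integral bounds the norm.
  have hbound : ∀ᵐ ξ : ℝ,
      ‖(2 * Real.pi * Complex.I * ξ : ℂ) ^ j • (𝓕 (U t) : L2State) ξ‖ ^ 2 ≤ F ξ := by
    filter_upwards [hdecay U₀ U hU t ht, hW, norm_fourier_le_integral_norm hint] with ξ h1 h2 h3
    set η := 2 * Real.pi * ξ with hη
    have hj0 : 0 ≤ η ^ (2 * j) := by rw [pow_mul]; positivity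
    have hjabs : (|η| ^ j) ^ 2 = η ^ (2 * j) := by
      rw [← pow_mul, mul_comm j, pow_mul, sq_abs, pow_mul]
    have hWξ : ‖(𝓕 W : L2State) ξ‖ ^ 2 =
        η ^ (2 * j) * (η ^ 2) ^ ℓ * ‖(𝓕 U₀ : L2State) ξ‖ ^ 2 := by
      rw [h2, norm_smul, norm_deriv_symbol_pow, mul_pow, ← hη, pow_add, mul_pow, hjabs,
        ← pow_mul |η|, mul_comm ℓ, pow_mul |η|, sq_abs]
    rw [norm_smul, norm_deriv_symbol_pow, mul_pow, ← hη, hjabs]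
    have h4 : ‖(𝓕 U₀ : L2State) ξ‖ ^ 2 ≤ m ^ 2 := by gcongr
    have hlow0 : 0 ≤ C * K * m ^ 2 * (η ^ (2 * j) * Real.exp (-(b / 16) * ((1 + t) * η ^ 6))) := by
      positivity
    have hhigh0 : 0 ≤ C * K * ((1 + t)⁻¹) ^ ℓ * ‖(𝓕 W : L2State) ξ‖ ^ 2 := by positivity
    have h5 := mul_le_mul_of_nonneg_left h1 hj0
    refine h5.trans ?_
    rw [hF]
    rcases hsplit t η ht with h6 | h6
    · refine le_trans ?_ (le_add_of_nonneg_right hhigh0)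
      calc _ ≤ η ^ (2 * j) * (C * (K * Real.exp (-(b / 16) * ((1 + t) * η ^ 6))) * m ^ 2) := by
            gcongr
        _ = _ := by ring
    · refine le_trans ?_ (le_add_of_nonneg_left hlow0)
      rw [hWξ]
      calc _ ≤ η ^ (2 * j) * (C * (K * ((1 + t)⁻¹ * η ^ 2) ^ ℓ) * ‖(𝓕 U₀ : L2State) ξ‖ ^ 2) := by
            gcongr
        _ = _ := by rw [mul_pow]; ring
  have hcont : Continuous fun ξ : ℝ => (2 * Real.pi * Complex.I * ξ : ℂ) ^ j := by fun_prop
  have hmeas : AEStronglyMeasurable (fun ξ : ℝ =>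
      (2 * Real.pi * Complex.I * ξ : ℂ) ^ j • (𝓕 (U t) : L2State) ξ) volume :=
    hcont.aestronglyMeasurable.smul (Lp.aestronglyMeasurable _)
  have hmem : MemLp (fun ξ : ℝ =>
      (2 * Real.pi * Complex.I * ξ : ℂ) ^ j • (𝓕 (U t) : L2State) ξ) 2 volume := by
    rw [memLp_two_iff_integrable_sq_norm hmeas]
    refine hFi.mono' (hmeas.norm.pow 2) ?_
    filter_upwards [hbound] with ξ h
    rwa [Real.norm_eq_abs, abs_of_nonneg (sq_nonneg _)]
  have hV : (𝓕 (𝓕⁻ (hmem.toLp) : L2State) : L2State) = hmem.toLp :=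
    FourierTransform.fourier_fourierInv_eq _
  refine ⟨𝓕⁻ (hmem.toLp), hasL2Deriv_of_fourier ?_, ?_⟩
  · rw [hV]
    exact hmem.coeFn_toLp
  set V : L2State := 𝓕⁻ (hmem.toLp) with hVdef
  have hnorm : ‖V‖ ^ 2 ≤ C * K * G * (m * √((s⁻¹) ^ (2 * j + 1))) ^ 2
      + C * K * (√(((1 + t)⁻¹) ^ ℓ) * ‖W‖) ^ 2 := by
    rw [mul_pow, mul_pow, Real.sq_sqrt (by positivity), Real.sq_sqrt (by positivity),
      ← Lp.norm_fourier_eq V, hV, norm_sq_eq_integral, ← Lp.norm_fourier_eq W,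
      norm_sq_eq_integral (𝓕 W : L2State)]
    calc ∫ ξ, ‖(hmem.toLp _ : L2State) ξ‖ ^ 2 ≤ ∫ ξ, F ξ := by
          refine integral_mono_ae ((Lp.memLp hmem.toLp).integrable_norm_pow two_ne_zero) hFi ?_
          filter_upwards [hbound, hmem.coeFn_toLp] with ξ h1 h2
          rw [h2]
          exact h1
      _ = C * K * m ^ 2 * (G * (s⁻¹) ^ (2 * j + 1)) +
          C * K * ((1 + t)⁻¹) ^ ℓ * ∫ ξ, ‖(𝓕 W : L2State) ξ‖ ^ 2 := by
          rw [hF, integral_add (hlowi.const_mul _) (hWi.const_mul _), integral_const_mul,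
            integral_const_mul, hloweq]
      _ = _ := by ring
  have hfin := sqrt_add_mul_le (by positivity) (by positivity) (by positivity) (by positivity) hnorm
  have e1 : √((s⁻¹) ^ (2 * j + 1)) = (1 + t) ^ (-(1 / 12 : ℝ) - (j : ℝ) / 6) := by
    rw [Real.sqrt_eq_rpow, hs, ← Real.rpow_neg ht1.le, ← Real.rpow_natCast,
      ← Real.rpow_mul ht1.le, ← Real.rpow_mul ht1.le]
    congr 1
    push_cast
    ring
  have e2 : √(((1 + t)⁻¹) ^ ℓ) = (1 + t) ^ (-((ℓ : ℝ) / 2)) := by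
    rw [Real.sqrt_eq_rpow, ← Real.rpow_neg_one, ← Real.rpow_natCast, ← Real.rpow_mul ht1.le,
      ← Real.rpow_mul ht1.le]
    congr 1
    ring
  rw [e1, e2] at hfin
  set A := (1 + t) ^ (-(1 / 12 : ℝ) - (j : ℝ) / 6) with hA
  set D := (1 + t) ^ (-((ℓ : ℝ) / 2)) with hD
  have hA0 : 0 ≤ A := Real.rpow_nonneg ht1.le _
  have hD0 : 0 ≤ D := Real.rpow_nonneg ht1.le _
  have p1 : 0 ≤ √(C * K) * A * m := by positivity
  have p2 : 0 ≤ √(C * K * G) * D * ‖W‖ := by positivity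
  linarith
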